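/- Let $K$ be a field. Let $A$ and $B$ be commutative (unital, associative) $K$-algebras, and let $(C,\Delta,\epsilon)$ be a cocommutative $K$-coalgebra; write $\Delta(c)=\sum c_1\otimes c_2$, and let $\Delta^p(c)=\sum c_1\otimes\cdots\otimes c_{p+1}\in C^{\otimes(p+1)}$ be the iterated coproduct. For $K$-algebras $R$, $S$, a measuring from $R$ to $S$ is a $K$-linear map $\phi:C\to \mathrm{Hom}_K(R,S)$ such that $\phi(c)(rr')=\sum \phi(c_1)(r)\,\phi(c_2)(r')$ and $\phi(c)(1_R)=\epsilon(c)\,1_S$ for all $c\in C$ and $r,r'\in R$; it is called cocommutative if $C$ is cocommutative. For a commutative $K$-algebra $A$, let $HH_\bullet(A)=\bigoplus_n HH_n(A)$ be the homology of the Hochschild complex $C_n(A)=A^{\otimes(n+1)}$ with differential $b=\sum_{i=0}^n(-1)^i d_i$, where $d_i(a_0,\dots,a_n)=(a_0,\dots,a_ia_{i+1},\dots,a_n)$ for $0\le i<n$ and $d_n(a_0,\dots,a_n)=(a_na_0,a_1,\dots,a_{n-1})$. Denote by $(HH_\bullet(A),sh)$ the $K$-algebra whose product is induced by the shuffle product $$(a_0,\dots,a_p)\times(a'_0,\dots,a'_q)=\sum_\sigma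 \mathrm{sgn}(\sigma)\,\sigma\cdot(a_0a'_0,a_1,\dots,a_p,a'_1,\dots,a'_q),$$ where the sum is over all $\sigma\in S_{p+q}$ with $\sigma(1)<\cdots<\sigma(p)$ and $\sigma(p+1)<\cdots<\sigma(p+q)$, and $\sigma\cdot(x_0,x_1,\dots,x_n)=(x_0,x_{\sigma^{-1}(1)},\dots,x_{\sigma^{-1}(n)})$; its unit is the class of $1_A$ in $HH_0(A)$. Let $\phi:C\to \mathrm{Hom}_K(A,B)$ be a (cocommutative) measuring from $A$ to $B$. For $c\in C$ the maps $$\tilde\phi(c)_p:C_p(A)\to C_p(B),\qquad (a_0,\dots,a_p)\mapsto \sum(\phi(c_1)(a_0),\dots,\phi(c_{p+1})(a_p))$$ commute with the Hochschild differentials, hence induce a map $\tilde\phi(c):HH_\bullet(A)\to HH_\bullet(B)$. Then the $K$-linear map $$\tilde\phi:C\to \mathrm{Hom}_K(HH_\bullet(A),HH_\bullet(B))$$ is a cocommutative measuring from $(HH_\bullet(A),sh)$ to $(HH_\bullet(B),sh)$. -/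

import Mathlib

set_option linter.unusedSectionVars false
set_option linter.unusedSimpArgs false

noncomputable section

open scoped TensorProduct DirectSum

/-! # Measurings and the shuffle product on Hochschild homology

The definitions, in order (everything else is a proof that they are well defined):
* `Hochschild.Chain`, `Hochschild.boundary`: the Hochschild complex of a commutative `K`-algebra, with
  the explicit formula `boundary_tprod` and `boundary_boundary` (`b ∘ b = 0`);
* `Hochschild.IsShuffle`, `Hochschild.shuffle`: the shuffle product, with the explicit formula
  `shuffle_tprod`;
* `Hochschild.HH`, `Hochschild.HHRing`: Hochschild homology and its ring structure, with the product
  `[x] [y] = [x × y]`;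
* `IsMeasuring`: coalgebra measurings of algebras;
* `Hochschild.iteratedComul`, `Hochschild.chainMap`, `Hochschild.inducedMap`: the iterated coproduct
  and the maps that a measuring induces on chains and on homology. -/

namespace Hochschild

section Merge

variable {ι κ τ : Type*} [Fintype ι] [Fintype κ] [DecidableEq κ] [Fintype τ] [DecidableEq τ]
variable {K A : Type*} [CommRing K] [CommRing A] [Algebra K A]

variable (K A) in
/-- For commutative `A`, the algebra map `A^{⊗ι} → A^{⊗κ}` induced by a map `f : ι → κ` of
(finite) index sets: it sends `⨂ⱼ aⱼ` to the tensor whose `k`-th entry is `∏_{f j = k} aⱼ`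
(see `mergeMap_tprod`). -/
def mergeMap (f : ι → κ) : (⨂[K] _ : ι, A) →ₐ[K] (⨂[K] _ : κ, A) :=
  PiTensorProduct.liftAlgHom
    ((MultilinearMap.mkPiAlgebra K ι (⨂[K] _ : κ, A)).compLinearMap fun j =>
      (PiTensorProduct.singleAlgHom (R := K) (A := fun _ : κ => A) (f j)).toLinearMap)
    (by simp [-PiTensorProduct.singleAlgHom_apply])
    (by intro x y; simp [-PiTensorProduct.singleAlgHom_apply, Pi.mul_apply, map_mul,
          Finset.prod_mul_distrib])

theorem mergeMap_tprod_eq_prod (f : ι → κ) (a : ι → A) :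
    mergeMap K A f (PiTensorProduct.tprod K a) =
      ∏ j, PiTensorProduct.singleAlgHom (R := K) (A := fun _ : κ => A) (f j) (a j) := by
  exact PiTensorProduct.lift.tprod a

theorem mergeMap_tprod (f : ι → κ) (a : ι → A) :
    mergeMap K A f (PiTensorProduct.tprod K a) =
      PiTensorProduct.tprod K (fun k => ∏ j with f j = k, a j) := by
  rw [mergeMap_tprod_eq_prod]
  simp only [PiTensorProduct.singleAlgHom_apply]
  rw [← PiTensorProduct.tprod_prod]
  congr 1
  ext k
  simp [Finset.prod_apply, Pi.mulSingle_apply, Finset.prod_filter, eq_comm]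

theorem mergeMap_single [DecidableEq ι] (f : ι → κ) (i : ι) (a : A) :
    mergeMap K A f (PiTensorProduct.singleAlgHom (R := K) (A := fun _ : ι => A) i a) =
      PiTensorProduct.singleAlgHom (R := K) (A := fun _ : κ => A) (f i) a := by
  rw [PiTensorProduct.singleAlgHom_apply, mergeMap_tprod_eq_prod, Finset.prod_eq_single i]
  · simp [-PiTensorProduct.singleAlgHom_apply]
  · intro j _ hj
    simp [-PiTensorProduct.singleAlgHom_apply, hj]
  · simp

theorem tprod_eq_prod (a : κ → A) : PiTensorProduct.tprod K a =
    ∏ j, PiTensorProduct.singleAlgHom (R := K) (A := fun _ : κ => A) j (a j) := by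
  refine Eq.trans ?_ (mergeMap_tprod_eq_prod (K := K) id a)
  rw [mergeMap_tprod]
  congr 1
  ext k
  simp [Finset.filter_eq']

end Merge

section Complex

variable (K A : Type*) [CommRing K] [CommRing A] [Algebra K A]

/-- Hochschild `n`-chains `C_n(A) = A^{⊗(n+1)}`, the tensor `(a₀, …, a_n)` being
`PiTensorProduct.tprod K a`. -/
abbrev Chain (n : ℕ) : Type _ := ⨂[K] _ : Fin (n + 1), A

/-- The Hochschild differential `b = ∑_{i=0}^{n+1} (-1)^i d_i : C_{n+1}(A) → C_n(A)`: for `i ≤ n` the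
face `d_i` multiplies the adjacent entries `i` and `i + 1`, and the last face sends
`(a₀, …, a_{n+1})` to `(a_{n+1} a₀, a₁, …, a_n)`.  The formula on tensors is `boundary_tprod`. -/
def boundary (n : ℕ) : Chain K A (n + 1) →ₗ[K] Chain K A n :=
  ∑ i : Fin (n + 1), (-1 : K) ^ (i : ℕ) • (mergeMap K A i.predAbove).toLinearMap +
    (-1 : K) ^ (n + 1) • (mergeMap K A (Fin.snoc id 0 : Fin (n + 2) → Fin (n + 1))).toLinearMap

variable {K A} in
/-- `b(a₀, …, a_{n+1}) = ∑_{i ≤ n} (-1)^i (…, a_i a_{i+1}, …) + (-1)^{n+1} (a_{n+1} a₀, a₁, …, a_n)`. -/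
theorem boundary_tprod (n : ℕ) (a : Fin (n + 2) → A) :
    boundary K A n (PiTensorProduct.tprod K a) =
      ∑ i : Fin (n + 1), (-1 : K) ^ (i : ℕ) •
        PiTensorProduct.tprod K (Fin.contractNth i.castSucc (· * ·) a) +
      (-1 : K) ^ (n + 1) • PiTensorProduct.tprod K
        (Function.update (Fin.init a) 0 (a (Fin.last (n + 1)) * a 0)) := by
  have h1 : ∀ i : Fin (n + 1), (fun k => ∏ j with i.predAbove j = k, a j) =
      Fin.contractNth i.castSucc (· * ·) a := fun i => by
    ext k
    rw [Finset.prod_filter, Fin.prod_univ_succAbove _ i.castSucc]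
    have h2 : ∀ j : Fin (n + 1), i.predAbove (i.castSucc.succAbove j) = j := by simp
    simp only [h2, Finset.prod_ite_eq', Finset.mem_univ, if_true]
    simp only [Fin.contractNth, Fin.predAbove_castSucc_self]
    rcases lt_trichotomy k.val i.val with h | h | h
    · have h3 : i ≠ k := by rintro rfl; omega
      rw [if_neg h3, Fin.succAbove_of_castSucc_lt _ _ (by rw [Fin.lt_def]; exact h)]
      simp [h]
    · obtain rfl : k = i := Fin.ext h
      simp
    · have h3 : i ≠ k := by rintro rfl; omega
      rw [if_neg h3, Fin.succAbove_of_le_castSucc _ _ (by rw [Fin.le_def]; exact h.le)]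
      have : ¬ k.val < i.val := by omega
      have h5 : k.val ≠ i.val := by omega
      simp [this, h5]
  have h2 : (fun k => ∏ j with (Fin.snoc id 0 : Fin (n + 2) → Fin (n + 1)) j = k, a j) =
      Function.update (Fin.init a) 0 (a (Fin.last (n + 1)) * a 0) := by
    ext k
    rw [Finset.prod_filter, Fin.prod_univ_castSucc]
    simp only [Fin.snoc_castSucc, Fin.snoc_last, id, Finset.prod_ite_eq', Finset.mem_univ, if_true]
    by_cases hk : k = 0
    · subst hk; simp [mul_comm]
    · simp [hk, Ne.symm hk, Fin.init]
  simp only [boundary, LinearMap.add_apply, LinearMap.sum_apply, LinearMap.smul_apply,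
    AlgHom.toLinearMap_apply, mergeMap_tprod, h1, h2]

/-- `σ` is a `(p, q)`-shuffle: `σ(1) < ⋯ < σ(p)` and `σ(p+1) < ⋯ < σ(p+q)`. -/
def IsShuffle (p q : ℕ) (σ : Equiv.Perm (Fin (p + q))) : Prop :=
  StrictMono (fun i : Fin p => σ (Fin.castAdd q i)) ∧
    StrictMono (fun j : Fin q => σ (Fin.natAdd p j))

open Classical in
/-- The shuffle product `C_p(A) ⊗ C_q(A) → C_{p+q}(A)`, the sum over the `(p, q)`-shuffles `σ` of
`sgn(σ)` times the tensor with `a₀ a₀'` in place `0`, `a_i` in place `σ(i)` and `a_j'` in place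
`σ(p + j)`.  The usual formula is `shuffle_tprod`. -/
def shuffle (p q : ℕ) : Chain K A p →ₗ[K] Chain K A q →ₗ[K] Chain K A (p + q) :=
  ∑ σ : Equiv.Perm (Fin (p + q)) with IsShuffle p q σ, ((Equiv.Perm.sign σ : ℤ) : K) •
    (LinearMap.mul K (Chain K A (p + q))).compl₁₂
      (mergeMap K A (Fin.cons 0 fun i => (σ (Fin.castAdd q i)).succ :
        Fin (p + 1) → Fin (p + q + 1))).toLinearMap
      (mergeMap K A (Fin.cons 0 fun j => (σ (Fin.natAdd p j)).succ :
        Fin (q + 1) → Fin (p + q + 1))).toLinearMap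

variable {K A} in
open Classical in
/-- `(a₀, …, a_p) × (a₀', …, a_q') = ∑_σ sgn(σ) σ · (a₀ a₀', a₁, …, a_p, a₁', …, a_q')` where
`σ · (x₀, x₁, …, x_n) = (x₀, x_{σ⁻¹(1)}, …, x_{σ⁻¹(n)})`. -/
theorem shuffle_tprod (p q : ℕ) (a : Fin (p + 1) → A) (a' : Fin (q + 1) → A) :
    shuffle K A p q (PiTensorProduct.tprod K a) (PiTensorProduct.tprod K a') =
      ∑ σ : Equiv.Perm (Fin (p + q)) with IsShuffle p q σ, ((Equiv.Perm.sign σ : ℤ) : K) •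
        PiTensorProduct.tprod K (Fin.cons (a 0 * a' 0)
          fun i => Fin.append (Fin.tail a) (Fin.tail a') (σ.symm i) : Fin (p + q + 1) → A) := by
  simp only [shuffle, LinearMap.sum_apply, LinearMap.smul_apply, LinearMap.compl₁₂_apply,
    AlgHom.toLinearMap_apply, LinearMap.mul_apply', mergeMap_tprod, PiTensorProduct.tprod_mul_tprod]
  refine Finset.sum_congr rfl fun σ _ => ?_
  congr 2
  ext k
  simp only [Pi.mul_apply, Finset.prod_filter, Fin.prod_univ_succ, Fin.cons_zero, Fin.cons_succ]
  induction k using Fin.cases with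
  | zero => simp
  | succ k =>
    obtain ⟨l, rfl⟩ := σ.surjective k
    simp only [Fin.succ_inj, σ.injective.eq_iff, (Fin.succ_ne_zero _).symm, if_false, one_mul]
    induction l using Fin.addCases with
    | left l =>
      have : ∀ j : Fin q, Fin.natAdd p j ≠ Fin.castAdd q l := fun j h => by
        have := congrArg Fin.val h; simp at this; omega
      simp [Fin.tail, this]
    | right l =>
      have : ∀ j : Fin p, Fin.castAdd q j ≠ Fin.natAdd p l := fun j h => by
        have := congrArg Fin.val h; simp at this; omega
      simp [Fin.tail, this]

end Complex

end Hochschild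

/-! ### Bookkeeping with words

The lemmas of this part live in free abelian groups on words in a commutative monoid.  They serve to
prove that `b ∘ b = 0`, that the shuffle product is associative and that `b` is a graded derivation
for it, which is what makes the shuffle product descend to homology. -/

namespace HochschildWord

section Words

variable {M : Type*} [CommMonoid M]

/-- Free abelian group on words. -/
abbrev F (M : Type*) := List M →₀ ℤ
/-- Free abelian group on pairs: a coefficient and a word. -/
abbrev P (M : Type*) := (M × List M) →₀ ℤ

def consF (a : M) : F M →ₗ[ℤ] F M := Finsupp.lmapDomain ℤ ℤ (List.cons a)
def consP (a : M) : P M →ₗ[ℤ] P M :=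
  Finsupp.lmapDomain ℤ ℤ (fun u => (u.1, a :: u.2))
def headF (m : M) : F M →ₗ[ℤ] P M := Finsupp.lmapDomain ℤ ℤ (fun w => (m, w))

/-- Signed shuffles of two words, recursively. -/
def sh : List M → List M → F M
  | [], y => Finsupp.single y 1
  | a :: x, [] => Finsupp.single (a :: x) 1
  | a :: x, b :: y =>
    consF a (sh x (b :: y)) + (-1 : ℤ) ^ (x.length + 1) • consF b (sh (a :: x) y)
termination_by x y => x.length + y.length

@[simp] lemma consF_single (a : M) (x : List M) (k : ℤ) :
    consF a (Finsupp.single x k) = Finsupp.single (a :: x) k := by simp [consF]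
@[simp] lemma consP_single (a m : M) (x : List M) (k : ℤ) :
    consP a (Finsupp.single (m, x) k) = Finsupp.single (m, a :: x) k := by simp [consP]
@[simp] lemma headF_single (m : M) (x : List M) (k : ℤ) :
    headF m (Finsupp.single x k) = Finsupp.single (m, x) k := by simp [headF]

lemma sh_nil_left (y : List M) : sh [] y = Finsupp.single y 1 := by rw [sh]
lemma sh_nil_right (x : List M) : sh x [] = Finsupp.single x 1 := by cases x <;> rw [sh]
lemma sh_cons_cons (a b : M) (x y : List M) : sh (a :: x) (b :: y) =
    consF a (sh x (b :: y)) + (-1 : ℤ) ^ (x.length + 1) • consF b (sh (a :: x) y) := by rw [sh]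

/-- The parity operator. -/
def par : F M →ₗ[ℤ] F M :=
  Finsupp.linearCombination ℤ (fun x => (-1 : ℤ) ^ x.length • Finsupp.single x 1)
lemma par_single (x : List M) : par (Finsupp.single x 1) =
  (-1 : ℤ) ^ x.length • Finsupp.single x 1 := by simp [par]
lemma par_consF (a : M) (u : F M) : par (consF a u) = - consF a (par u) := by
  suffices h : par ∘ₗ consF a = - (consF a ∘ₗ par) from LinearMap.congr_fun h u
  ext1 x; ext1
  simp [par, pow_succ]
lemma par_sh (x y : List M) : par (sh x y) = (-1 : ℤ) ^ (x.length + y.length) • sh x y := by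
  induction x generalizing y with
  | nil => simp [sh_nil_left, par]
  | cons a x ihx =>
    induction y with
    | nil => simp [sh_nil_right, par]
    | cons b y ihy =>
      rw [sh_cons_cons, map_add, map_smul, par_consF, par_consF, ihx, ihy]
      simp only [List.length_cons, map_smul, pow_add, pow_one]
      module

def shL : F M →ₗ[ℤ] F M →ₗ[ℤ] F M :=
  Finsupp.lift _ ℤ _ (fun x => Finsupp.lift _ ℤ _ (fun y => sh x y))
@[simp] lemma shL_single (x y : List M) :
    shL (Finsupp.single x 1) (Finsupp.single y 1) = sh x y := by simp [shL]

lemma hom2_ext {ι κ N : Type*} [AddCommGroup N] {f g : (ι →₀ ℤ) →ₗ[ℤ] (κ →₀ ℤ) →ₗ[ℤ] N}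
    (h : ∀ i j, f (Finsupp.single i 1) (Finsupp.single j 1) =
      g (Finsupp.single i 1) (Finsupp.single j 1)) : f = g := by
  ext i j; simpa using h i j

lemma shL_consF_consF (a b : M) (u v : F M) : shL (consF a u) (consF b v) =
    consF a (shL u (consF b v)) + consF b (shL (par (consF a u)) v) := by
  suffices h : (shL.compl₁₂ (consF a) (consF b)) = (shL.compl₁₂ .id (consF b)).compr₂ (consF a)
      + (shL.compl₁₂ (par ∘ₗ consF a) .id).compr₂ (consF b) from
    LinearMap.congr_fun (LinearMap.congr_fun h u) v
  refine hom2_ext fun x y => ?_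
  simp only [LinearMap.compl₁₂_apply, LinearMap.compr₂_apply, LinearMap.add_apply,
    LinearMap.comp_apply, LinearMap.id_apply, consF_single, shL_single, sh_cons_cons, par_single,
    map_smul, LinearMap.smul_apply, List.length_cons]

lemma shL_assoc (x y z : List M) :
    shL (sh x y) (Finsupp.single z 1) = shL (Finsupp.single x 1) (sh y z) := by
  induction x generalizing y z with
  | nil =>
    have h : ∀ u : F M, shL (Finsupp.single [] 1) u = u := fun u => by
      suffices h : shL (Finsupp.single ([] : List M) 1) = .id from LinearMap.congr_fun h u
      ext1 x; ext1; simp [sh_nil_left]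
    simp [h, sh_nil_left]
  | cons a x ihx =>
    induction y generalizing z with
    | nil => simp [sh_nil_left, sh_nil_right]
    | cons b y ihy =>
      induction z with
      | nil =>
        have h : ∀ u : F M, shL u (Finsupp.single [] 1) = u := fun u => by
          suffices h : shL.flip (Finsupp.single ([] : List M) 1) = .id from
            LinearMap.congr_fun h u
          ext1 x; ext1; simp [sh_nil_right]
        simp [h, sh_nil_right]
      | cons c z ihz =>
        have e1 : shL (sh (a :: x) (b :: y)) (Finsupp.single (c :: z) 1) =
            consF a (shL (sh x (b :: y)) (Finsupp.single (c :: z) 1)) +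
            (-1 : ℤ) ^ (x.length + 1) • consF b (shL (sh (a :: x) y) (Finsupp.single (c :: z) 1)) +
            (-1 : ℤ) ^ (x.length + 1 + (y.length + 1)) •
              consF c (shL (sh (a :: x) (b :: y)) (Finsupp.single z 1)) := by
          have := par_sh (a :: x) (b :: y)
          simp only [List.length_cons] at this
          have e0 : (-1 : ℤ) ^ (x.length + 1 + (y.length + 1)) •
              consF c (shL (sh (a :: x) (b :: y)) (Finsupp.single z 1)) =
              consF c (shL (par (sh (a :: x) (b :: y))) (Finsupp.single z 1)) := by
            rw [this, map_smul, LinearMap.smul_apply, map_smul]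
          rw [e0, sh_cons_cons]
          simp only [map_add, LinearMap.add_apply, map_smul, LinearMap.smul_apply,
            ← consF_single c z, shL_consF_consF]
          module
        have e2 : shL (Finsupp.single (a :: x) 1) (sh (b :: y) (c :: z)) =
            consF a (shL (Finsupp.single x 1) (sh (b :: y) (c :: z))) +
            (-1 : ℤ) ^ (x.length + 1) • consF b (shL (Finsupp.single (a :: x) 1) (sh y (c :: z))) +
            (-1 : ℤ) ^ (x.length + 1 + (y.length + 1)) •
              consF c (shL (Finsupp.single (a :: x) 1) (sh (b :: y) z)) := by
          rw [sh_cons_cons]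
          simp only [map_add, map_smul, ← consF_single a x, shL_consF_consF]
          simp only [consF_single, par_single, List.length_cons, map_smul, LinearMap.smul_apply,
            pow_add, pow_one]
          module
        rw [e1, e2, ihx, ihy, ihz]

def mrg (m a : M) : List M → M × List M
  | [] => (a * m, [])
  | b :: x => (m, (a * b) :: x)

/-- All faces of `(m; w)` but the first one, with signs. -/
def bE (m : M) : List M → P M
  | [] => 0
  | a :: x => - Finsupp.single (mrg m a x) 1 - consP a (bE m x)

/-- The first face of `(m; w)`. -/
def bL (m : M) : List M → P M
  | [] => 0
  | a :: x => Finsupp.single (m * a, x) 1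

def shP : P M →ₗ[ℤ] P M →ₗ[ℤ] P M :=
  Finsupp.lift _ ℤ _ (fun x => Finsupp.lift _ ℤ _ (fun y => headF (x.1 * y.1) (sh x.2 y.2)))
@[simp] lemma shP_single (x y : M × List M) :
    shP (Finsupp.single x 1) (Finsupp.single y 1) = headF (x.1 * y.1) (sh x.2 y.2) := by simp [shP]

def parP : P M →ₗ[ℤ] P M :=
  Finsupp.linearCombination ℤ (fun x => (-1 : ℤ) ^ x.2.length • Finsupp.single x 1)
@[simp] lemma parP_single (x : M × List M) : parP (Finsupp.single x 1) =
  (-1 : ℤ) ^ x.2.length • Finsupp.single x 1 := by simp [parP]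

lemma headF_consF (m a : M) (u : F M) : headF m (consF a u) = consP a (headF m u) := by
  suffices h : headF m ∘ₗ consF a = consP a ∘ₗ headF m from LinearMap.congr_fun h u
  ext1 x; ext1; simp

lemma shP_consP_consP (a b : M) (u v : P M) : shP (consP a u) (consP b v) =
    consP a (shP u (consP b v)) + consP b (shP (parP (consP a u)) v) := by
  suffices h : (shP.compl₁₂ (consP a) (consP b)) = (shP.compl₁₂ .id (consP b)).compr₂ (consP a)
      + (shP.compl₁₂ (parP ∘ₗ consP a) .id).compr₂ (consP b) from
    LinearMap.congr_fun (LinearMap.congr_fun h u) v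
  refine hom2_ext fun x y => ?_
  obtain ⟨m, x⟩ := x
  obtain ⟨n, y⟩ := y
  simp only [LinearMap.compl₁₂_apply, LinearMap.compr₂_apply, LinearMap.add_apply,
    LinearMap.comp_apply, LinearMap.id_apply, consP_single, shP_single, sh_cons_cons, parP_single,
    map_smul, LinearMap.smul_apply, List.length_cons, map_add, headF_consF]

def bEL (m : M) : F M →ₗ[ℤ] P M := Finsupp.lift _ ℤ _ (bE m)
@[simp] lemma bEL_single (m : M) (x) : bEL m (Finsupp.single x 1) = bE m x := by simp [bEL]
def bLL (m : M) : F M →ₗ[ℤ] P M := Finsupp.lift _ ℤ _ (bL m)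
@[simp] lemma bLL_single (m : M) (x) : bLL m (Finsupp.single x 1) = bL m x := by simp [bLL]
def mrgL (m a : M) : F M →ₗ[ℤ] P M :=
  Finsupp.lift _ ℤ _ (fun x => Finsupp.single (mrg m a x) 1)
@[simp] lemma mrgL_single (m a : M) (x) : mrgL m a (Finsupp.single x 1) =
  Finsupp.single (mrg m a x) 1 := by simp [mrgL]

lemma bEL_consF (m a : M) (u : F M) :
    bEL m (consF a u) = - mrgL m a u - consP a (bEL m u) := by
  suffices h : bEL m ∘ₗ consF a = - mrgL m a - consP a ∘ₗ bEL m from LinearMap.congr_fun h u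
  ext1 x; ext1; simp [bE]
lemma bLL_consF (m a : M) (u : F M) :
    bLL m (consF a u) = headF (m * a) u := by
  suffices h : bLL m ∘ₗ consF a = headF (m * a) from LinearMap.congr_fun h u
  ext1 x; ext1; simp [bL]
lemma mrgL_consF (m a b : M) (u : F M) :
    mrgL m a (consF b u) = headF m (consF (a * b) u) := by
  suffices h : mrgL m a ∘ₗ consF b = headF m ∘ₗ consF (a * b) from LinearMap.congr_fun h u
  ext1 x; ext1; simp [mrg]

lemma mrg_sh_left (m n a b : M) (x y : List M) :
    mrgL (m * n) a (sh x (b :: y)) =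
      shP (Finsupp.single (mrg m a x) 1) (Finsupp.single (n, b :: y) 1)
      - (-1 : ℤ) ^ x.length • consP b (shP (Finsupp.single (mrg m a x) 1) (Finsupp.single (n, y) 1))
      + (-1 : ℤ) ^ x.length • headF (m * n) (consF (a * b) (sh x y)) := by
  cases x with
  | nil => simp [sh_nil_left, mrg]
  | cons a' x =>
    simp [sh_cons_cons, mrg, mrgL_consF, headF_consF]

lemma mrg_sh_right (m n a b : M) (x y : List M) :
    mrgL (m * n) b (sh (a :: x) y) =
      shP (Finsupp.single (m, a :: x) 1) (Finsupp.single (mrg n b y) 1)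
      - consP a (shP (Finsupp.single (m, x) 1) (Finsupp.single (mrg n b y) 1))
      + headF (m * n) (consF (a * b) (sh x y)) := by
  cases y with
  | nil => simp [sh_nil_right, mrg, mul_comm, mul_left_comm]
  | cons b' y =>
    simp [sh_cons_cons, mrg, mrgL_consF, headF_consF, mul_comm a b]
    abel

lemma shP_nil_left (m n : M) (y : List M) :
    shP (Finsupp.single (m, []) 1) (bE n y) = bE (m * n) y := by
  have key : ∀ (a : M) (u : P M), shP (Finsupp.single (m, []) 1) (consP a u) =
      consP a (shP (Finsupp.single (m, []) 1) u) := fun a u => by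
    suffices h : shP (Finsupp.single (m, []) 1) ∘ₗ consP a =
      consP a ∘ₗ (shP (Finsupp.single (m, []) 1)) from LinearMap.congr_fun h u
    ext1 x; ext1; obtain ⟨x, w⟩ := x; simp [sh_nil_left]
  induction y with
  | nil => simp [bE]
  | cons b y ih =>
    simp only [bE, map_sub, map_neg, key, ih]
    cases y <;> simp [mrg, sh_nil_left, mul_left_comm]

lemma shP_nil_right (m n : M) (y : List M) :
    shP (bE n y) (Finsupp.single (m, []) 1) = bE (n * m) y := by
  have key : ∀ (a : M) (u : P M), shP (consP a u) (Finsupp.single (m, []) 1) =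
      consP a (shP u (Finsupp.single (m, []) 1)) := fun a u => by
    suffices h : shP.flip (Finsupp.single (m, []) 1) ∘ₗ consP a =
      consP a ∘ₗ (shP.flip (Finsupp.single (m, []) 1)) from LinearMap.congr_fun h u
    ext1 x; ext1; obtain ⟨x, w⟩ := x; simp [sh_nil_right]
  induction y with
  | nil => simp [bE]
  | cons b y ih =>
    simp only [bE, map_sub, map_neg, key, ih, LinearMap.sub_apply, LinearMap.neg_apply]
    cases y <;> simp [mrg, sh_nil_right, mul_assoc]

/-- `parP` anticommutes with the boundary -/
lemma parP_bE (m : M) (x : List M) : parP (bE m x) = (-1 : ℤ) ^ (x.length + 1) • bE m x := by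
  have key : ∀ (a : M) (u : P M), parP (consP a u) = - consP a (parP u) := fun a u => by
    suffices h : parP ∘ₗ consP a = - (consP a ∘ₗ parP) from LinearMap.congr_fun h u
    ext1 x; ext1; obtain ⟨x, w⟩ := x; simp [pow_succ]
  induction x with
  | nil => simp [bE]
  | cons a x ih =>
    have hl : (mrg m a x).2.length = x.length := by cases x <;> simp [mrg]
    simp only [bE, map_sub, map_neg, key, ih, parP_single, hl, List.length_cons, map_smul, pow_succ]
    module

lemma bE_sh (m n : M) (x y : List M) : bEL (m * n) (sh x y) =
    shP (bE m x) (Finsupp.single (n, y) 1) +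
      (-1 : ℤ) ^ x.length • shP (Finsupp.single (m, x) 1) (bE n y) := by
  induction x generalizing y with
  | nil => simp [sh_nil_left, shP_nil_left, bE]
  | cons a x ihx =>
    induction y with
    | nil =>
      rw [shP_nil_right, sh_nil_right, bEL_single]
      simp only [bE, map_zero, smul_zero, add_zero]
    | cons b y ihy =>
      have hpar : parP (consP a (bE m x)) = (-1 : ℤ) ^ x.length • consP a (bE m x) := by
        have key : ∀ (a : M) (u : P M), parP (consP a u) = - consP a (parP u) := fun a u => by
          suffices h : parP ∘ₗ consP a = - (consP a ∘ₗ parP) from LinearMap.congr_fun h u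
          ext1 x; ext1; obtain ⟨x, w⟩ := x; simp [pow_succ]
        rw [key, parP_bE, map_smul, pow_succ]; module
      have h1 : shP (bE m (a :: x)) (Finsupp.single (n, b :: y) 1) =
          - shP (Finsupp.single (mrg m a x) 1) (Finsupp.single (n, b :: y) 1)
          - consP a (shP (bE m x) (Finsupp.single (n, b :: y) 1))
          - (-1 : ℤ) ^ x.length • consP b (shP (consP a (bE m x)) (Finsupp.single (n, y) 1)) := by
        rw [bE]
        simp only [map_sub, map_neg, LinearMap.sub_apply, LinearMap.neg_apply]
        rw [← consP_single b n y, shP_consP_consP, hpar]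
        simp only [map_smul, LinearMap.smul_apply]
        module
      have h2 : shP (Finsupp.single (m, a :: x) 1) (bE n (b :: y)) =
          - shP (Finsupp.single (m, a :: x) 1) (Finsupp.single (mrg n b y) 1)
          - consP a (shP (Finsupp.single (m, x) 1) (consP b (bE n y)))
          - (-1 : ℤ) ^ (x.length + 1) •
            consP b (shP (Finsupp.single (m, a :: x) 1) (bE n y)) := by
        rw [bE]
        simp only [map_sub, map_neg]
        rw [← consP_single a m x, shP_consP_consP, consP_single, parP_single]
        simp only [map_smul, LinearMap.smul_apply, List.length_cons]
        module
      rw [h1, h2, sh_cons_cons, map_add, map_smul, bEL_consF, bEL_consF, ihx, ihy,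
        mrg_sh_left, mrg_sh_right]
      simp only [bE, map_sub, map_neg, map_add, map_smul, LinearMap.sub_apply, LinearMap.neg_apply,
        List.length_cons, pow_succ]
      rcases neg_one_pow_eq_or ℤ x.length with h | h <;> rw [h] <;> module

lemma bL_sh (m n : M) (x y : List M) : bLL (m * n) (sh x y) =
    shP (bL m x) (Finsupp.single (n, y) 1) +
      (-1 : ℤ) ^ x.length • shP (Finsupp.single (m, x) 1) (bL n y) := by
  cases x with
  | nil => cases y <;> simp [sh_nil_left, bL, mul_assoc]
  | cons a x =>
    cases y with
    | nil => simp [sh_nil_right, bL, mul_right_comm]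
    | cons b y =>
      simp [sh_cons_cons, bLL_consF, bL, mul_assoc, mul_comm, mul_left_comm]

/-- The Hochschild boundary of `(m; w)`. -/
def bW (u : M × List M) : P M := bL u.1 u.2 + bE u.1 u.2
def bP : P M →ₗ[ℤ] P M := Finsupp.lift _ ℤ _ bW
@[simp] lemma bP_single (u : M × List M) : bP (Finsupp.single u 1) = bW u := by simp [bP]

lemma bP_shP (u v : M × List M) : bP (shP (Finsupp.single u 1) (Finsupp.single v 1)) =
    shP (bW u) (Finsupp.single v 1) + (-1 : ℤ) ^ u.2.length • shP (Finsupp.single u 1) (bW v) := by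
  have h : ∀ (m : M) (w : F M), bP (headF m w) = bLL m w + bEL m w := fun m w => by
    suffices h : bP ∘ₗ headF m = bLL m + bEL m from LinearMap.congr_fun h w
    ext1 x; ext1; simp [bW]
  rw [shP_single, h, bE_sh, bL_sh]
  simp only [bW, map_add, LinearMap.add_apply]
  module

lemma shP_assoc (u v w : M × List M) :
    shP (shP (Finsupp.single u 1) (Finsupp.single v 1)) (Finsupp.single w 1) =
    shP (Finsupp.single u 1) (shP (Finsupp.single v 1) (Finsupp.single w 1)) := by
  have h1 : ∀ (m : M) (f : F M) (w : M × List M), shP (headF m f) (Finsupp.single w 1) =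
      headF (m * w.1) (shL f (Finsupp.single w.2 1)) := fun m f w => by
    suffices h : shP.flip (Finsupp.single w 1) ∘ₗ headF m =
      headF (m * w.1) ∘ₗ shL.flip (Finsupp.single w.2 1) from LinearMap.congr_fun h f
    ext1 x; ext1; simp
  have h2 : ∀ (m : M) (f : F M) (w : M × List M), shP (Finsupp.single w 1) (headF m f) =
      headF (w.1 * m) (shL (Finsupp.single w.2 1) f) := fun m f w => by
    suffices h : shP (Finsupp.single w 1) ∘ₗ headF m =
      headF (w.1 * m) ∘ₗ shL (Finsupp.single w.2 1) from LinearMap.congr_fun h f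
    ext1 x; ext1; simp
  rw [shP_single, shP_single, h1, h2, shL_assoc, mul_assoc]


/-- Shuffle condition for a permutation of `n` letters cut after the first `p`. -/
def IsSh {n : ℕ} (p : ℕ) (σ : Equiv.Perm (Fin n)) : Prop :=
  (∀ i j : Fin n, i < j → j.val < p → σ i < σ j) ∧ (∀ i j : Fin n, i < j → p ≤ i.val → σ i < σ j)

/-- The permutation sending `i` to `0` and acting as `τ` on the other letters. -/
def glue {n : ℕ} (i : Fin (n + 1)) (τ : Equiv.Perm (Fin n)) :
    Equiv.Perm (Fin (n + 1)) :=
  Equiv.Perm.decomposeFin.symm (0, τ) * i.cycleRange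

lemma glue_self {n : ℕ} (i : Fin (n + 1)) (τ : Equiv.Perm (Fin n)) : glue i τ i = 0 := by
  simp [glue]
lemma glue_succAbove {n : ℕ} (i : Fin (n + 1)) (τ : Equiv.Perm (Fin n)) (k : Fin n) :
    glue i τ (i.succAbove k) = (τ k).succ := by
  simp [glue, Fin.cycleRange_succAbove]
lemma glue_symm_zero {n : ℕ} (i : Fin (n + 1)) (τ : Equiv.Perm (Fin n)) :
    (glue i τ).symm 0 = i := by
  rw [Equiv.symm_apply_eq, glue_self]
lemma glue_symm_succ {n : ℕ} (i : Fin (n + 1)) (τ : Equiv.Perm (Fin n)) (k : Fin n) :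
    (glue i τ).symm k.succ = i.succAbove (τ.symm k) := by
  rw [Equiv.symm_apply_eq, glue_succAbove]; simp
lemma sign_glue {n : ℕ} (i : Fin (n + 1)) (τ : Equiv.Perm (Fin n)) :
    ((Equiv.Perm.sign (glue i τ) : ℤˣ) : ℤ) = (-1) ^ i.val * (Equiv.Perm.sign τ : ℤˣ) := by
  simp [glue, Fin.sign_cycleRange, mul_comm]

lemma glue_bijective (n : ℕ) : Function.Bijective
    (fun x : Fin (n + 1) × Equiv.Perm (Fin n) => glue x.1 x.2) := by
  rw [Fintype.bijective_iff_injective_and_card]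
  refine ⟨?_, by simp [Fintype.card_perm, Nat.factorial_succ]⟩
  rintro ⟨i, τ⟩ ⟨j, ρ⟩ h
  have hij : i = j := by
    have := glue_symm_zero i τ
    simp only at h
    rw [h, glue_symm_zero] at this
    exact this.symm
  subst hij
  simpa [glue] using h

lemma isSh_glue_zero {n : ℕ} (τ : Equiv.Perm (Fin n)) (p : ℕ) :
    IsSh p (glue 0 τ) ↔ IsSh (p - 1) τ := by
  have h0 := glue_self 0 τ
  have hs : ∀ k : Fin n, glue 0 τ k.succ = (τ k).succ := fun k => by
    simpa using glue_succAbove 0 τ k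
  constructor
  · rintro ⟨h1, h2⟩
    refine ⟨fun i j hij hj => ?_, fun i j hij hi => ?_⟩
    · have := h1 i.succ j.succ (by simpa using hij) (by simp; omega)
      simpa [hs] using this
    · have := h2 i.succ j.succ (by simpa using hij) (by simp; omega)
      simpa [hs] using this
  · rintro ⟨h1, h2⟩
    refine ⟨fun i j hij hj => ?_, fun i j hij hi => ?_⟩
    · induction j using Fin.cases with
      | zero => simp at hij
      | succ j =>
        induction i using Fin.cases with
        | zero => rw [h0, hs]; exact Fin.succ_pos _
        | succ i =>
          rw [hs, hs, Fin.succ_lt_succ_iff]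
          exact h1 i j (by simpa using hij) (by simp at hj; omega)
    · induction j using Fin.cases with
      | zero => simp at hij
      | succ j =>
        induction i using Fin.cases with
        | zero => rw [h0, hs]; exact Fin.succ_pos _
        | succ i =>
          rw [hs, hs, Fin.succ_lt_succ_iff]
          exact h2 i j (by simpa using hij) (by simp at hi; omega)

lemma isSh_glue_mid {n : ℕ} (τ : Equiv.Perm (Fin n)) (i : Fin (n + 1)) :
    IsSh i.val (glue i τ) ↔ IsSh i.val τ := by
  have h0 := glue_self i τ
  have hs := glue_succAbove i τ
  have hv : ∀ k : Fin n, (i.succAbove k).val = if k.val < i.val then k.val else k.val + 1 := by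
    intro k
    by_cases h : k.val < i.val
    · rw [Fin.succAbove_of_castSucc_lt _ _ (by simpa [Fin.lt_def] using h)]; simp [h]
    · rw [Fin.succAbove_of_le_castSucc _ _ (by simpa [Fin.le_def] using h)]; simp [h]
  constructor
  · rintro ⟨h1, h2⟩
    refine ⟨fun a b hab hb => ?_, fun a b hab ha => ?_⟩
    · have := h1 (i.succAbove a) (i.succAbove b) (by simpa using hab) (by rw [hv]; split_ifs; omega)
      simpa [hs] using this
    · have := h2 (i.succAbove a) (i.succAbove b) (by simpa using hab) (by rw [hv]; split_ifs <;> omega)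
      simpa [hs] using this
  · rintro ⟨h1, h2⟩
    refine ⟨fun a b hab hb => ?_, fun a b hab ha => ?_⟩
    · rcases Fin.eq_self_or_eq_succAbove i b with rfl | ⟨b, rfl⟩
      · omega
      rcases Fin.eq_self_or_eq_succAbove i a with rfl | ⟨a, rfl⟩
      · have := Fin.lt_def.1 hab; omega
      rw [hs, hs, Fin.succ_lt_succ_iff]
      refine h1 a b (by simpa using hab) ?_
      rw [hv] at hb; split_ifs at hb <;> omega
    · rcases Fin.eq_self_or_eq_succAbove i b with rfl | ⟨b, rfl⟩
      · have := Fin.lt_def.1 hab; omega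
      rcases Fin.eq_self_or_eq_succAbove i a with rfl | ⟨a, rfl⟩
      · rw [h0, hs]; exact Fin.succ_pos _
      rw [hs, hs, Fin.succ_lt_succ_iff]
      refine h2 a b (by simpa using hab) ?_
      rw [hv] at ha; split_ifs at ha <;> omega

lemma not_isSh_glue {n : ℕ} (τ : Equiv.Perm (Fin n)) (i : Fin (n + 1)) (p : ℕ) (hi : i ≠ 0)
    (hp : p ≠ i.val) : ¬ IsSh p (glue i τ) := by
  rintro ⟨h1, h2⟩
  have h0 := glue_self i τ
  have hi' : 0 < i.val := Nat.pos_of_ne_zero fun h => hi (Fin.ext (by simpa using h))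
  rcases Nat.lt_or_gt_of_ne hp with h | h
  · have := h2 ⟨p, by omega⟩ i (by simpa [Fin.lt_def] using h) le_rfl
    rw [h0] at this; simp at this
  · have := h1 0 i (by rw [Fin.lt_def]; exact hi') h
    rw [h0] at this; simp at this

lemma ofFn_glue {n : ℕ} (i : Fin (n + 1)) (τ : Equiv.Perm (Fin n)) (v : Fin (n + 1) → M) :
    List.ofFn (v ∘ (glue i τ).symm) = v i :: List.ofFn ((v ∘ i.succAbove) ∘ τ.symm) := by
  rw [List.ofFn_succ]
  simp only [Function.comp_apply, glue_symm_zero, glue_symm_succ, Function.comp_def]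

open Classical in
/-- Signed sum over the shuffle permutations. -/
def shSum {n : ℕ} (p : ℕ) (v : Fin n → M) : F M :=
  ∑ σ : Equiv.Perm (Fin n), if IsSh p σ then
    ((Equiv.Perm.sign σ : ℤˣ) : ℤ) • Finsupp.single (List.ofFn (v ∘ σ.symm)) 1 else 0

lemma shSum_succ {n : ℕ} (p : ℕ) (v : Fin (n + 1) → M) : shSum p v =
    consF (v 0) (shSum (p - 1) (v ∘ Fin.succ)) +
    if h : 0 < p ∧ p ≤ n then (-1 : ℤ) ^ p • consF (v ⟨p, by omega⟩)
      (shSum p (v ∘ (⟨p, by omega⟩ : Fin (n + 1)).succAbove)) else 0 := by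
  classical
  have step : shSum p v = ∑ i : Fin (n + 1), ∑ τ : Equiv.Perm (Fin n),
      if IsSh p (glue i τ) then ((-1 : ℤ) ^ i.val) • consF (v i)
        (((Equiv.Perm.sign τ : ℤˣ) : ℤ) •
          Finsupp.single (List.ofFn ((v ∘ i.succAbove) ∘ τ.symm)) 1) else 0 := by
    rw [shSum, ← (Equiv.ofBijective _ (glue_bijective n)).sum_comp, Fintype.sum_prod_type]
    refine Finset.sum_congr rfl fun i _ => Finset.sum_congr rfl fun τ _ => ?_
    simp only [Equiv.ofBijective_apply]
    split_ifs
    · rw [sign_glue, ofFn_glue, map_smul, consF_single, mul_smul]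
    · rfl
  have hzero : (∑ τ : Equiv.Perm (Fin n), if IsSh p (glue 0 τ) then
      ((-1 : ℤ) ^ (0 : Fin (n + 1)).val) • consF (v 0)
        (((Equiv.Perm.sign τ : ℤˣ) : ℤ) •
          Finsupp.single (List.ofFn ((v ∘ (0 : Fin (n + 1)).succAbove) ∘ τ.symm)) 1) else 0) =
      consF (v 0) (shSum (p - 1) (v ∘ Fin.succ)) := by
    rw [shSum, map_sum]
    refine Finset.sum_congr rfl fun τ _ => ?_
    simp only [isSh_glue_zero, Fin.succAbove_zero]
    split_ifs <;> simp
  rw [step]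
  split_ifs with h
  · have hne : (0 : Fin (n + 1)) ≠ ⟨p, by omega⟩ := by
      intro h'; have := congrArg Fin.val h'; simp at this; omega
    rw [Fintype.sum_eq_add 0 ⟨p, by omega⟩ hne, hzero]
    · refine congrArg _ ?_
      rw [shSum, map_sum, Finset.smul_sum]
      refine Finset.sum_congr rfl fun τ _ => ?_
      have hm := isSh_glue_mid τ ⟨p, by omega⟩
      dsimp only at hm
      by_cases hs : IsSh p τ
      · rw [if_pos hs, if_pos (hm.2 hs)]
      · rw [if_neg hs, if_neg (fun h' => hs (hm.1 h')), map_zero, smul_zero]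
    · rintro i ⟨hi0, hip⟩
      refine Finset.sum_eq_zero fun τ _ => if_neg (not_isSh_glue τ i p hi0 ?_)
      rintro rfl; exact hip rfl
  · rw [Fintype.sum_eq_single 0, hzero, add_zero]
    intro i hi0
    refine Finset.sum_eq_zero fun τ _ => if_neg (not_isSh_glue τ i p hi0 ?_)
    rintro rfl
    have : i.val ≠ 0 := fun h' => hi0 (Fin.ext (by simpa using h'))
    omega

lemma shSum_eq {n : ℕ} (p : ℕ) (hp : p ≤ n) (v : Fin n → M) :
    shSum p v = sh ((List.ofFn v).take p) ((List.ofFn v).drop p) := by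
  induction n generalizing p with
  | zero =>
    obtain rfl : p = 0 := by omega
    simp [shSum, sh_nil_left, IsSh]
  | succ n ih =>
    rw [shSum_succ, ih _ (by omega)]
    rcases p with _ | p
    · simp [sh_nil_left, Function.comp_def]
    · split_ifs with h
      · rw [ih _ h.2]
        obtain ⟨w, hw⟩ : ∃ w : Fin (n + 1), w = ⟨p + 1, by omega⟩ := ⟨_, rfl⟩
        rw [← hw]
        have hwv : w.val = p + 1 := by rw [hw]
        have hv : ∀ k : Fin n, (w.succAbove k).val = if k.val < p + 1 then k.val else k.val + 1 := by
          intro k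
          by_cases h : k.val < p + 1
          · rw [Fin.succAbove_of_castSucc_lt _ _ (by rw [Fin.lt_def, hwv]; simpa using h)]; simp [h]
          · rw [Fin.succAbove_of_le_castSucc _ _ (by rw [Fin.le_def, hwv]; simpa using h)]; simp [h]
        have e1 : (List.ofFn (v ∘ w.succAbove)).take (p + 1) = (List.ofFn v).take (p + 1) := by
          refine List.ext_getElem (by simp; omega) fun k h1 h2 => ?_
          simp only [List.getElem_take, List.getElem_ofFn, Function.comp]
          congr 1
          ext
          rw [hv]
          simp at h1
          rw [if_pos (by dsimp only; omega)]
        have e2 : (List.ofFn (v ∘ w.succAbove)).drop (p + 1) = (List.ofFn v).drop (p + 2) := by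
          refine List.ext_getElem (by simp) fun k h1 h2 => ?_
          simp only [List.getElem_drop, List.getElem_ofFn, Function.comp]
          congr 1
          ext
          rw [hv, if_neg (by dsimp only; omega)]
          dsimp only; omega
        have e3 : (List.ofFn v).drop (p + 1) = v w :: (List.ofFn v).drop (p + 2) := by
          rw [List.drop_eq_getElem_cons (by simp; omega)]
          simp [hw]
        rw [e1, e2]
        have e4 : (List.ofFn v).drop (p + 1) = (List.ofFn (v ∘ Fin.succ)).drop p := by
          rw [List.ofFn_succ]; simp [Function.comp_def]
        have e5 : (List.ofFn v).take (p + 1) = v 0 :: (List.ofFn (v ∘ Fin.succ)).take p := by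
          rw [List.ofFn_succ]; simp [Function.comp_def]
        rw [Nat.add_sub_cancel, ← e4, e3, e5, sh_cons_cons]
        have e6 : ((List.ofFn (v ∘ Fin.succ)).take p).length = p := by simp; omega
        rw [e6]
      · have : p = n := by omega
        subst this
        have e : (List.ofFn v).take (p + 1) = v 0 :: (List.ofFn (v ∘ Fin.succ)).take p := by
          rw [List.ofFn_succ]; simp [Function.comp_def]
        rw [Nat.add_sub_cancel, e]
        have : (List.ofFn v).drop (p + 1) = [] := by simp
        rw [this]
        have : (List.ofFn (v ∘ Fin.succ)).drop p = [] := by simp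
        rw [this, sh_nil_right, sh_nil_right]
        simp

def mulP (a : M) : P M →ₗ[ℤ] P M := Finsupp.lmapDomain ℤ ℤ (fun u => (u.1 * a, u.2))
def mrgP (a : M) : P M →ₗ[ℤ] P M := Finsupp.lmapDomain ℤ ℤ (fun u => mrg u.1 a u.2)
def bEP : P M →ₗ[ℤ] P M := Finsupp.lift _ ℤ _ (fun u => bE u.1 u.2)
def bLP : P M →ₗ[ℤ] P M := Finsupp.lift _ ℤ _ (fun u => bL u.1 u.2)

lemma mulP_single (a : M) (u : M × List M) (k : ℤ) :
    mulP a (Finsupp.single u k) = Finsupp.single (u.1 * a, u.2) k := by simp [mulP]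
lemma mrgP_single (a : M) (u : M × List M) (k : ℤ) :
    mrgP a (Finsupp.single u k) = Finsupp.single (mrg u.1 a u.2) k := by simp [mrgP]
lemma bEP_single (u : M × List M) : bEP (Finsupp.single u 1) = bE u.1 u.2 := by simp [bEP]
lemma bLP_single (u : M × List M) : bLP (Finsupp.single u 1) = bL u.1 u.2 := by simp [bLP]

lemma homP_ext {f g : P M →ₗ[ℤ] P M}
    (h : ∀ m x, f (Finsupp.single (m, x) 1) = g (Finsupp.single (m, x) 1)) (u : P M) :
    f u = g u := by
  suffices e : f = g by rw [e]
  ext1 ⟨m, x⟩; ext1; exact h m x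

lemma bEP_consP (a : M) (u : P M) : bEP (consP a u) = - mrgP a u - consP a (bEP u) :=
  homP_ext (f := bEP ∘ₗ consP a) (g := - mrgP a - consP a ∘ₗ bEP) (fun m x => by
    simp [bEP_single, mrgP_single, bE]) u
lemma bLP_consP (a : M) (u : P M) : bLP (consP a u) = mulP a u :=
  homP_ext (f := bLP ∘ₗ consP a) (g := mulP a) (fun m x => by
    simp [bLP_single, mulP_single, bL]) u
lemma mrgP_consP (a c : M) (u : P M) : mrgP a (consP c u) = consP (a * c) u :=
  homP_ext (f := mrgP a ∘ₗ consP c) (g := consP (a * c)) (fun m x => by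
    simp [mrgP_single, mrg]) u
lemma mrgP_mrgP (a c : M) (u : P M) : mrgP a (mrgP c u) = mrgP (a * c) u :=
  homP_ext (f := mrgP a ∘ₗ mrgP c) (g := mrgP (a * c)) (fun m x => by
    cases x <;> simp [mrgP_single, mrg, mul_assoc]) u
lemma mulP_consP (a c : M) (u : P M) : mulP a (consP c u) = consP c (mulP a u) :=
  homP_ext (f := mulP a ∘ₗ consP c) (g := consP c ∘ₗ mulP a) (fun m x => by
    simp [mulP_single]) u

lemma bE_cons (m a : M) (x : List M) :
    bE m (a :: x) = - mrgP a (Finsupp.single (m, x) 1) - consP a (bE m x) := by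
  simp [bE, mrgP_single]

lemma bEP_mrg (m a : M) (x : List M) :
    bEP (Finsupp.single (mrg m a x) 1) = mrgP a (bE m x) := by
  cases x with
  | nil => simp [mrg, bEP_single, bE]
  | cons c x =>
    rw [mrg, bEP_single, bE_cons, bE_cons, map_sub, map_neg, mrgP_mrgP, mrgP_consP]

lemma bEP_bE (m : M) (x : List M) : bEP (bE m x) = 0 := by
  induction x with
  | nil => simp [bE]
  | cons a x ih =>
    rw [bE_cons, map_sub, map_neg, mrgP_single, bEP_mrg, bEP_consP, ih, map_zero]
    abel

lemma bE_mul (m a : M) (x : List M) : bE (m * a) x = mulP a (bE m x) := by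
  induction x with
  | nil => simp [bE]
  | cons c x ih =>
    rw [bE_cons, bE_cons, ih, map_sub, map_neg, mulP_consP]
    cases x <;> simp [mulP_single, mrgP_single, mrg, mul_assoc]

lemma bP_bW (u : M × List M) : bP (bW u) = 0 := by
  have h : ∀ w : P M, bP w = bLP w + bEP w :=
    homP_ext (f := bP) (g := bLP + bEP) (fun m x => by simp [bW, bLP_single, bEP_single])
  obtain ⟨m, x⟩ := u
  cases x with
  | nil => simp [bW, bL, bE]
  | cons a x =>
    have e : bLP (Finsupp.single (mrg m a x) 1) = bL (m * a) x := by
      cases x <;> simp [mrg, bLP_single, bL, mul_assoc]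
    have e2 : bLP (bE m (a :: x)) = - bL (m * a) x - bE (m * a) x := by
      rw [bE_cons, map_sub, map_neg, mrgP_single, e, bLP_consP, bE_mul]
    dsimp only [bW]
    rw [map_add, h (bE m (a :: x)), bEP_bE, e2, bL, bP_single, bW]
    abel

end Words

end HochschildWord

namespace Hochschild

section Transport

open HochschildWord DirectSum

variable {K A : Type*} [CommRing K] [CommRing A] [Algebra K A]

variable (K A) in
/-- All Hochschild chains together. -/
abbrev Tot : Type _ := ⨁ n : ℕ, Chain K A n

variable (K A) in
/-- The differential on all chains. -/
def totBoundary : Tot K A →ₗ[K] Tot K A :=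
  DirectSum.toModule K ℕ _ fun n => match n with
    | 0 => 0
    | n + 1 => DirectSum.lof K ℕ (Chain K A) n ∘ₗ boundary K A n

variable (K A) in
/-- The shuffle product on all chains. -/
def totShuffle : Tot K A →ₗ[K] Tot K A →ₗ[K] Tot K A :=
  DirectSum.toModule K ℕ _ fun p => LinearMap.flip <| DirectSum.toModule K ℕ _ fun q =>
    LinearMap.flip <| (shuffle K A p q).compr₂ (DirectSum.lof K ℕ (Chain K A) (p + q))

theorem totBoundary_lof_zero (x : Chain K A 0) :
    totBoundary K A (DirectSum.lof K ℕ (Chain K A) 0 x) = 0 := by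
  simp [totBoundary]

theorem totBoundary_lof_succ (n : ℕ) (x : Chain K A (n + 1)) :
    totBoundary K A (DirectSum.lof K ℕ (Chain K A) (n + 1) x) =
      DirectSum.lof K ℕ (Chain K A) n (boundary K A n x) := by
  simp [totBoundary]

theorem totShuffle_lof (p q : ℕ) (x : Chain K A p) (y : Chain K A q) :
    totShuffle K A (DirectSum.lof K ℕ (Chain K A) p x) (DirectSum.lof K ℕ (Chain K A) q y) =
      DirectSum.lof K ℕ (Chain K A) (p + q) (shuffle K A p q x y) := by
  simp [totShuffle]

variable (K) in
def wordTensor (u : A × List A) : Tot K A :=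
  DirectSum.lof K ℕ (Chain K A) u.2.length
    (PiTensorProduct.tprod K (Fin.cons u.1 u.2.get : Fin (u.2.length + 1) → A))

variable (K A) in
def wordHom : P A →+ Tot K A :=
  Finsupp.liftAddHom fun u => zmultiplesHom _ (wordTensor K u)

theorem wordHom_single (u : A × List A) :
    wordHom K A (Finsupp.single u 1) = wordTensor K u := by
  simp [wordHom]

theorem wordHom_smul (z : ℤ) (u : P A) : wordHom K A (z • u) = (z : K) • wordHom K A u := by
  simpa using map_intCast_smul (wordHom K A) ℤ K z u

theorem lof_tprod_congr {m n : ℕ} (h : m = n) (f : Fin (m + 1) → A) (g : Fin (n + 1) → A)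
    (hfg : ∀ i, f i = g (Fin.cast (by rw [h]) i)) :
    DirectSum.lof K ℕ (Chain K A) m (PiTensorProduct.tprod K f) =
      DirectSum.lof K ℕ (Chain K A) n (PiTensorProduct.tprod K g) := by
  subst h
  congr 2
  ext i
  exact hfg i

theorem wordTensor_ofFn {n : ℕ} (m : A) (f : Fin n → A) : wordTensor K (m, List.ofFn f) =
    DirectSum.lof K ℕ (Chain K A) n
      (PiTensorProduct.tprod K (Fin.cons m f : Fin (n + 1) → A)) := by
  refine lof_tprod_congr (by simp) _ _ fun i => ?_
  induction i using Fin.cases with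
  | zero => rfl
  | succ i => simp; rfl

theorem isSh_iff (p q : ℕ) (σ : Equiv.Perm (Fin (p + q))) : IsSh p σ ↔ IsShuffle p q σ := by
  constructor
  · rintro ⟨h1, h2⟩
    exact ⟨fun i j hij => h1 _ _ (Fin.lt_def.2 (by simpa using Fin.lt_def.1 hij)) (by simp),
      fun i j hij => h2 _ _ (Fin.lt_def.2 (by simpa using Fin.lt_def.1 hij)) (by simp)⟩
  · rintro ⟨h1, h2⟩
    refine ⟨fun i j hij hj => ?_, fun i j hij hi => ?_⟩
    · have h := Fin.lt_def.1 hij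
      exact @h1 ⟨i, by omega⟩ ⟨j, hj⟩ hij
    · have h := Fin.lt_def.1 hij
      have := @h2 ⟨i - p, by omega⟩ ⟨j - p, by omega⟩ (by rw [Fin.lt_def]; dsimp only; omega)
      have e : ∀ k : Fin (p + q), p ≤ k.val → ∀ h', Fin.natAdd p ⟨k - p, h'⟩ = k := by
        intro k hk h'; ext; simp; omega
      simpa [e i hi, e j (by omega)] using this

theorem wordHom_shP_ofFn {p q : ℕ} (m n : A) (f : Fin p → A) (g : Fin q → A) :
    wordHom K A (shP (Finsupp.single (m, List.ofFn f) 1) (Finsupp.single (n, List.ofFn g) 1)) =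
      totShuffle K A (wordTensor K (m, List.ofFn f)) (wordTensor K (n, List.ofFn g)) := by
  classical
  have h := shSum_eq p (Nat.le_add_right p q) (Fin.append f g)
  rw [List.ofFn_fin_append, List.take_left' (by simp), List.drop_left' (by simp)] at h
  rw [wordTensor_ofFn, wordTensor_ofFn, totShuffle_lof, shuffle_tprod, shP_single]
  dsimp only
  rw [← h, shSum, map_sum, map_sum, map_sum, Finset.sum_filter]
  refine Finset.sum_congr rfl fun σ _ => ?_
  by_cases hσ : IsShuffle p q σ
  · rw [if_pos hσ, if_pos ((isSh_iff p q σ).2 hσ), map_smul, headF_single, wordHom_smul,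
      wordHom_single, wordTensor_ofFn, map_smul]
    rfl
  · rw [if_neg hσ, if_neg (fun h' => hσ ((isSh_iff p q σ).1 h'))]
    simp

theorem ofFn_exists (u : A × List A) : ∃ (n : ℕ) (m : A) (f : Fin n → A),
    u = (m, List.ofFn f) := ⟨u.2.length, u.1, u.2.get, by simp⟩

theorem wordHom_shP (u v : P A) :
    wordHom K A (shP u v) = totShuffle K A (wordHom K A u) (wordHom K A v) := by
  induction u using Finsupp.induction_linear with
  | zero => simp
  | add u u' h h' => simp [h, h']
  | single u k =>
    induction v using Finsupp.induction_linear with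
    | zero => simp
    | add v v' h h' => simp only [map_add, h, h']
    | single v l =>
      obtain ⟨p, m, f, rfl⟩ := ofFn_exists u
      obtain ⟨q, n, g, rfl⟩ := ofFn_exists v
      have e : ∀ (u : A × List A) (k : ℤ), Finsupp.single u k = k • Finsupp.single u 1 := by simp
      rw [e _ k, e _ l]
      simp only [map_smul, LinearMap.smul_apply, wordHom_smul, wordHom_shP_ofFn, wordHom_single]

theorem contractNth_succ_cons {n : ℕ} (m : A) (w : Fin (n + 1) → A) (i : Fin n) :
    (Fin.contractNth i.castSucc.succ (· * ·) (Fin.cons m w : Fin (n + 2) → A)) =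
      Fin.cons m (Fin.contractNth i.castSucc (· * ·) w) := by
  ext k
  induction k using Fin.cases with
  | zero => simp [Fin.contractNth]
  | succ k =>
    simp only [Fin.contractNth, Fin.cons_succ, Fin.val_succ, Nat.add_lt_add_iff_right,
      Nat.add_right_cancel_iff]
    rfl

theorem contractNth_zero_cons {n : ℕ} (m : A) (w : Fin (n + 1) → A) :
    (Fin.contractNth 0 (· * ·) (Fin.cons m w : Fin (n + 2) → A)) =
      Fin.cons (m * w 0) (Fin.tail w) := by
  ext k
  induction k using Fin.cases with
  | zero => simp [Fin.contractNth]
  | succ k => simp [Fin.contractNth, Fin.tail]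

theorem bE_ofFn {n : ℕ} (m : A) (w : Fin (n + 1) → A) : bE m (List.ofFn w) =
    ∑ i : Fin n, (-1 : ℤ) ^ (i.val + 1) •
      Finsupp.single (m, List.ofFn (Fin.contractNth i.castSucc (· * ·) w)) 1 +
    (-1 : ℤ) ^ (n + 1) • Finsupp.single (w (Fin.last n) * m, List.ofFn (Fin.init w)) 1 := by
  induction n with
  | zero => simp [bE, mrg]
  | succ n ih =>
    obtain ⟨a, w, rfl⟩ : ∃ a w', w = Fin.cons a w' := ⟨w 0, Fin.tail w, by simp⟩
    rw [List.ofFn_cons, bE, ih, Fin.sum_univ_succ]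
    have e1 : mrg m a (List.ofFn w) =
        (m, List.ofFn (Fin.contractNth 0 (· * ·) (Fin.cons a w : Fin (n + 2) → A))) := by
      rw [contractNth_zero_cons, List.ofFn_cons, List.ofFn_succ]; rfl
    have e2 : List.ofFn (Fin.init (Fin.cons a w : Fin (n + 2) → A)) =
        a :: List.ofFn (Fin.init w) := by
      rw [← List.ofFn_cons]; congr 1; 
      ext k
      induction k using Fin.cases with
      | zero => rfl
      | succ k => rfl
    have e3 : ∀ i : Fin n, List.ofFn (Fin.contractNth i.succ.castSucc (· * ·)
        (Fin.cons a w : Fin (n + 2) → A)) =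
        a :: List.ofFn (Fin.contractNth i.castSucc (· * ·) w) := fun i => by
      rw [← List.ofFn_cons, ← contractNth_succ_cons]; rfl
    rw [e1, e2]
    simp only [e3, map_add, map_sum, map_smul, consP_single, Fin.castSucc_zero, Fin.val_succ,
      Fin.val_zero, ← Fin.succ_last, Fin.cons_succ]
    rw [pow_succ (-1 : ℤ) (n + 1)]
    have e4 : ∀ i : Fin n, (-1 : ℤ) ^ (i.val + 1 + 1) = - (-1) ^ (i.val + 1) := fun i => by
      rw [pow_succ]; simp
    simp only [e4, neg_smul, Finset.sum_neg_distrib]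
    module

theorem wordHom_bW (u : A × List A) :
    wordHom K A (bW u) = totBoundary K A (wordTensor K u) := by
  obtain ⟨n, m, f, rfl⟩ := ofFn_exists u
  rw [wordTensor_ofFn]
  rcases n with _ | n
  · simp [bW, bL, bE, totBoundary_lof_zero]
  · rw [totBoundary_lof_succ, boundary_tprod, Fin.sum_univ_succ, bW]
    dsimp only
    rw [bE_ofFn]
    have e1 : bL m (List.ofFn f) = Finsupp.single (m * f 0, List.ofFn (Fin.tail f)) 1 := by
      rw [List.ofFn_succ]; rfl
    have e2 : (Fin.contractNth (0 : Fin (n + 1)).castSucc (· * ·)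
        (Fin.cons m f : Fin (n + 2) → A)) = Fin.cons (m * f 0) (Fin.tail f) :=
      contractNth_zero_cons m f
    have e3 : ∀ i : Fin n, (Fin.contractNth i.succ.castSucc (· * ·)
        (Fin.cons m f : Fin (n + 2) → A)) =
        Fin.cons m (Fin.contractNth i.castSucc (· * ·) f) := fun i =>
      contractNth_succ_cons m f i
    have e4 : Function.update (Fin.init (Fin.cons m f : Fin (n + 2) → A)) 0
        ((Fin.cons m f : Fin (n + 2) → A) (Fin.last (n + 1)) *
          (Fin.cons m f : Fin (n + 2) → A) 0) =
        (Fin.cons (f (Fin.last n) * m) (Fin.init f) : Fin (n + 1) → A) := by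
      rw [← Fin.succ_last, Fin.cons_succ, Fin.cons_zero]
      ext k
      induction k using Fin.cases with
      | zero => simp
      | succ k => simp [Fin.init]
    rw [e1, e2, e4]
    simp only [e3, map_add, map_sum, map_smul, wordHom_smul, wordHom_single, wordTensor_ofFn]
    simp
    abel

theorem wordHom_bP (u : P A) : wordHom K A (bP u) = totBoundary K A (wordHom K A u) := by
  induction u using Finsupp.induction_linear with
  | zero => simp
  | add u u' h h' => simp [h, h']
  | single u k =>
    have e : ∀ (u : A × List A) (k : ℤ), Finsupp.single u k = k • Finsupp.single u 1 := by simp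
    rw [e _ k]
    simp only [map_smul, wordHom_smul, wordHom_single, bP_single, wordHom_bW]

theorem lof_tprod_eq {n : ℕ} (a : Fin (n + 1) → A) :
    DirectSum.lof K ℕ (Chain K A) n (PiTensorProduct.tprod K a) =
      wordHom K A (Finsupp.single (a 0, List.ofFn (Fin.tail a)) 1) := by
  rw [wordHom_single, wordTensor_ofFn, Fin.cons_self_tail]

theorem boundary_boundary (n : ℕ) (x : Chain K A (n + 2)) :
    boundary K A n (boundary K A (n + 1) x) = 0 := by
  suffices h : boundary K A n ∘ₗ boundary K A (n + 1) = 0 from LinearMap.congr_fun h x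
  refine PiTensorProduct.ext (MultilinearMap.ext fun a => ?_)
  apply DirectSum.of_injective (β := Chain K A) n
  simp only [← DirectSum.lof_eq_of K, LinearMap.compMultilinearMap_apply, LinearMap.comp_apply]
  rw [← totBoundary_lof_succ, ← totBoundary_lof_succ, lof_tprod_eq, ← wordHom_bP, ← wordHom_bP,
    bP_single, bP_bW]
  simp

/-- The graded Leibniz rule `b(x × y) = b(x) × y + (-1)^p x × b(y)`. -/
theorem totBoundary_totShuffle (p : ℕ) (x : Chain K A p) (y : Tot K A) :
    totBoundary K A (totShuffle K A (DirectSum.lof K ℕ (Chain K A) p x) y) =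
      totShuffle K A (totBoundary K A (DirectSum.lof K ℕ (Chain K A) p x)) y +
      (-1 : K) ^ p • totShuffle K A (DirectSum.lof K ℕ (Chain K A) p x) (totBoundary K A y) := by
  suffices h : ((totShuffle K A).compr₂ (totBoundary K A)) ∘ₗ DirectSum.lof K ℕ (Chain K A) p =
      (totShuffle K A ∘ₗ totBoundary K A) ∘ₗ DirectSum.lof K ℕ (Chain K A) p +
      (-1 : K) ^ p • ((totShuffle K A).compl₂ (totBoundary K A)) ∘ₗ
        DirectSum.lof K ℕ (Chain K A) p from
    LinearMap.congr_fun (LinearMap.congr_fun h x) y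
  refine PiTensorProduct.ext (MultilinearMap.ext fun a => ?_)
  refine DirectSum.linearMap_ext K fun q => PiTensorProduct.ext (MultilinearMap.ext fun b => ?_)
  simp only [LinearMap.compMultilinearMap_apply, LinearMap.comp_apply, LinearMap.compr₂_apply,
    LinearMap.compl₂_apply, LinearMap.add_apply, LinearMap.smul_apply]
  rw [lof_tprod_eq, lof_tprod_eq, ← wordHom_shP, ← wordHom_bP, bP_shP, map_add, wordHom_smul,
    wordHom_shP, wordHom_shP, ← wordHom_bP, ← wordHom_bP, bP_single, bP_single]
  simp

theorem totShuffle_assoc (x y z : Tot K A) :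
    totShuffle K A (totShuffle K A x y) z = totShuffle K A x (totShuffle K A y z) := by
  suffices h : (totShuffle K A).flip z ∘ₗ (totShuffle K A).flip y =
      (totShuffle K A).flip (totShuffle K A y z) from LinearMap.congr_fun h x
  refine DirectSum.linearMap_ext K fun p => PiTensorProduct.ext (MultilinearMap.ext fun a => ?_)
  change totShuffle K A (totShuffle K A (lof K ℕ (Chain K A) p (PiTensorProduct.tprod K a)) y) z =
    totShuffle K A (lof K ℕ (Chain K A) p (PiTensorProduct.tprod K a)) (totShuffle K A y z)
  generalize hu : lof K ℕ (Chain K A) p (PiTensorProduct.tprod K a) = u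
  suffices h : (totShuffle K A).flip z ∘ₗ totShuffle K A u =
      totShuffle K A u ∘ₗ (totShuffle K A).flip z from LinearMap.congr_fun h y
  refine DirectSum.linearMap_ext K fun q => PiTensorProduct.ext (MultilinearMap.ext fun b => ?_)
  change totShuffle K A (totShuffle K A u (lof K ℕ (Chain K A) q (PiTensorProduct.tprod K b))) z =
    totShuffle K A u (totShuffle K A (lof K ℕ (Chain K A) q (PiTensorProduct.tprod K b)) z)
  generalize hv : lof K ℕ (Chain K A) q (PiTensorProduct.tprod K b) = v
  suffices h : totShuffle K A (totShuffle K A u v) =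
      totShuffle K A u ∘ₗ totShuffle K A v from LinearMap.congr_fun h z
  refine DirectSum.linearMap_ext K fun r => PiTensorProduct.ext (MultilinearMap.ext fun c => ?_)
  change totShuffle K A (totShuffle K A u v) (lof K ℕ (Chain K A) r (PiTensorProduct.tprod K c)) =
    totShuffle K A u (totShuffle K A v (lof K ℕ (Chain K A) r (PiTensorProduct.tprod K c)))
  subst hu hv
  rw [lof_tprod_eq, lof_tprod_eq, lof_tprod_eq]
  simp only [← wordHom_shP, shP_assoc]

theorem totShuffle_one_left (c : A) (q : ℕ) (y : Fin (q + 1) → A) :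
    totShuffle K A (lof K ℕ (Chain K A) 0 (PiTensorProduct.tprod K fun _ => c))
      (lof K ℕ (Chain K A) q (PiTensorProduct.tprod K y)) =
    lof K ℕ (Chain K A) q (PiTensorProduct.tprod K (Fin.cons (c * y 0) (Fin.tail y))) := by
  rw [lof_tprod_eq, lof_tprod_eq, ← wordHom_shP, shP_single]
  simp [sh_nil_left, wordHom_single, wordTensor_ofFn]

theorem totShuffle_one_right (c : A) (q : ℕ) (y : Fin (q + 1) → A) :
    totShuffle K A (lof K ℕ (Chain K A) q (PiTensorProduct.tprod K y))
      (lof K ℕ (Chain K A) 0 (PiTensorProduct.tprod K fun _ => c)) =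
    lof K ℕ (Chain K A) q (PiTensorProduct.tprod K (Fin.cons (y 0 * c) (Fin.tail y))) := by
  rw [lof_tprod_eq, lof_tprod_eq, ← wordHom_shP, shP_single]
  simp [sh_nil_right, wordHom_single, wordTensor_ofFn]

end Transport

end Hochschild

namespace Hochschild

section Homology

open DirectSum

variable (K A : Type*) [CommRing K] [CommRing A] [Algebra K A]

/-- Hochschild cycles: the kernel of `b` (everything in degree `0`). -/
def cycles : (n : ℕ) → Submodule K (Chain K A n)
  | 0 => ⊤
  | n + 1 => LinearMap.ker (boundary K A n)

/-- Hochschild boundaries: the image of `b`. -/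
def boundaries (n : ℕ) : Submodule K (Chain K A n) := LinearMap.range (boundary K A n)

/-- Hochschild homology `HH_n(A) = ker b / im b`. -/
def HH (n : ℕ) : Type _ := cycles K A n ⧸ (boundaries K A n).submoduleOf (cycles K A n)

instance (n : ℕ) : AddCommGroup (HH K A n) :=
  inferInstanceAs (AddCommGroup (cycles K A n ⧸ (boundaries K A n).submoduleOf (cycles K A n)))

instance (n : ℕ) : Module K (HH K A n) :=
  inferInstanceAs (Module K (cycles K A n ⧸ (boundaries K A n).submoduleOf (cycles K A n)))

/-- The homology class of a cycle. -/
def HH.mk (n : ℕ) : cycles K A n →ₗ[K] HH K A n :=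
  ((boundaries K A n).submoduleOf (cycles K A n)).mkQ

variable {K A}

theorem boundaries_le_cycles (n : ℕ) : boundaries K A n ≤ cycles K A n := by
  rintro _ ⟨y, rfl⟩
  cases n with
  | zero => exact Submodule.mem_top
  | succ n => exact boundary_boundary n y

theorem HH.mk_surjective (n : ℕ) : Function.Surjective (HH.mk K A n) :=
  Submodule.mkQ_surjective _

theorem HH.mk_eq_zero {n : ℕ} (x : cycles K A n) :
    HH.mk K A n x = 0 ↔ (x : Chain K A n) ∈ boundaries K A n :=
  Submodule.Quotient.mk_eq_zero _

theorem mem_cycles {n : ℕ} (x : Chain K A n) :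
    x ∈ cycles K A n ↔ totBoundary K A (lof K ℕ (Chain K A) n x) = 0 := by
  cases n with
  | zero => simp [cycles, totBoundary_lof_zero]
  | succ n =>
    rw [cycles, LinearMap.mem_ker, totBoundary_lof_succ, DirectSum.lof_eq_of]
    exact ((map_eq_zero_iff _ (DirectSum.of_injective n)).symm)

theorem component_totBoundary (n : ℕ) (y : Tot K A) :
    DirectSum.component K ℕ (Chain K A) n (totBoundary K A y) =
      boundary K A n (DirectSum.component K ℕ (Chain K A) (n + 1) y) := by
  suffices h : DirectSum.component K ℕ (Chain K A) n ∘ₗ totBoundary K A =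
      boundary K A n ∘ₗ DirectSum.component K ℕ (Chain K A) (n + 1) from LinearMap.congr_fun h y
  refine DirectSum.linearMap_ext K fun m => LinearMap.ext fun x => ?_
  simp only [LinearMap.comp_apply]
  cases m with
  | zero =>
    rw [totBoundary_lof_zero, DirectSum.component.of]
    simp
  | succ m =>
    rw [totBoundary_lof_succ, DirectSum.component.of, DirectSum.component.of]
    by_cases h : m = n
    · subst h; simp
    · have : m + 1 ≠ n + 1 := by omega
      simp [h]

theorem mem_boundaries {n : ℕ} (x : Chain K A n) :
    x ∈ boundaries K A n ↔ lof K ℕ (Chain K A) n x ∈ LinearMap.range (totBoundary K A) := by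
  constructor
  · rintro ⟨y, rfl⟩
    exact ⟨lof K ℕ (Chain K A) (n + 1) y, totBoundary_lof_succ n y⟩
  · rintro ⟨y, hy⟩
    refine ⟨DirectSum.component K ℕ (Chain K A) (n + 1) y, ?_⟩
    rw [← component_totBoundary, hy, DirectSum.component.lof_self]

theorem shuffle_mem_cycles {p q : ℕ} {x : Chain K A p} {y : Chain K A q}
    (hx : x ∈ cycles K A p) (hy : y ∈ cycles K A q) : shuffle K A p q x y ∈ cycles K A (p + q) := by
  rw [mem_cycles] at *
  rw [← totShuffle_lof, totBoundary_totShuffle, hx, hy]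
  simp

theorem shuffle_mem_boundaries_left {p q : ℕ} {x : Chain K A p} {y : Chain K A q}
    (hx : x ∈ boundaries K A p) (hy : y ∈ cycles K A q) :
    shuffle K A p q x y ∈ boundaries K A (p + q) := by
  obtain ⟨z, rfl⟩ := hx
  rw [mem_boundaries, ← totShuffle_lof, ← totBoundary_lof_succ]
  refine ⟨totShuffle K A (lof K ℕ (Chain K A) (p + 1) z) (lof K ℕ (Chain K A) q y), ?_⟩
  rw [totBoundary_totShuffle, (mem_cycles y).1 hy]
  simp

theorem shuffle_mem_boundaries_right {p q : ℕ} {x : Chain K A p} {y : Chain K A q}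
    (hx : x ∈ cycles K A p) (hy : y ∈ boundaries K A q) :
    shuffle K A p q x y ∈ boundaries K A (p + q) := by
  obtain ⟨z, rfl⟩ := hy
  rw [mem_boundaries, ← totShuffle_lof, ← totBoundary_lof_succ]
  refine ⟨(-1 : K) ^ p •
    totShuffle K A (lof K ℕ (Chain K A) p x) (lof K ℕ (Chain K A) (q + 1) z), ?_⟩
  rw [map_smul, totBoundary_totShuffle, (mem_cycles x).1 hx, smul_add, smul_smul, ← mul_pow]
  simp

variable (K A) in
/-- The shuffle product of cycles. -/
def cyclesShuffle (p q : ℕ) : cycles K A p →ₗ[K] cycles K A q →ₗ[K] cycles K A (p + q) :=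
  LinearMap.mk₂ K (fun x y => ⟨shuffle K A p q x y, shuffle_mem_cycles x.2 y.2⟩)
    (fun _ _ _ => Subtype.ext (by simp)) (fun _ _ _ => Subtype.ext (by simp))
    (fun _ _ _ => Subtype.ext (by simp)) (fun _ _ _ => Subtype.ext (by simp))

variable (K A) in
/-- The product `HH_p(A) × HH_q(A) → HH_{p+q}(A)` induced by the shuffle product, `[x] [y] = [x × y]`
(see `HH.shuffle_mk`). -/
def HH.shuffle (p q : ℕ) : HH K A p →ₗ[K] HH K A q →ₗ[K] HH K A (p + q) :=
  Submodule.liftQ _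
    (LinearMap.flip <| Submodule.liftQ _
      (LinearMap.flip <| (cyclesShuffle K A p q).compr₂ (HH.mk K A (p + q)))
      (fun y hy => LinearMap.ext fun x =>
        (HH.mk_eq_zero _).2 (shuffle_mem_boundaries_right x.2 hy)))
    (fun x hx => LinearMap.ext fun y => by
      obtain ⟨y, rfl⟩ := HH.mk_surjective q y
      exact (HH.mk_eq_zero _).2 (shuffle_mem_boundaries_left hx y.2))

theorem HH.shuffle_mk (p q : ℕ) (x : cycles K A p) (y : cycles K A q) :
    HH.shuffle K A p q (HH.mk K A p x) (HH.mk K A q y) =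
      HH.mk K A (p + q) ⟨Hochschild.shuffle K A p q x y, shuffle_mem_cycles x.2 y.2⟩ := rfl

variable (K A) in
/-- The map `A → HH_0(A)`, `a ↦ [(a)]`. -/
def HH.ofAlgebra : A →ₗ[K] HH K A 0 :=
  HH.mk K A 0 ∘ₗ LinearMap.codRestrict (cycles K A 0)
    (PiTensorProduct.singleAlgHom (R := K) (A := fun _ : Fin 1 => A) 0).toLinearMap
    (fun _ => Submodule.mem_top)

theorem HH.gradedMonoid_eq {m n : ℕ} (h : m = n) (x : cycles K A m) (y : cycles K A n)
    (hxy : lof K ℕ (Chain K A) m x = lof K ℕ (Chain K A) n y) :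
    GradedMonoid.mk (A := HH K A) m (HH.mk K A m x) = GradedMonoid.mk n (HH.mk K A n y) := by
  subst h
  rw [DirectSum.lof_eq_of] at hxy
  rw [Subtype.ext (DirectSum.of_injective m hxy)]

/-- The unit of the Hochschild homology ring is the class of `1` in `HH_0(A)`. -/
instance : GradedMonoid.GOne (HH K A) where one := HH.ofAlgebra K A 1
/-- The product of the Hochschild homology ring is the shuffle product. -/
instance : GradedMonoid.GMul (HH K A) where mul {p q} x y := HH.shuffle K A p q x y

theorem totShuffle_ofAlgebra_left (c : A) (y : Tot K A) :
    totShuffle K A (lof K ℕ (Chain K A) 0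
      (PiTensorProduct.singleAlgHom (R := K) (A := fun _ : Fin 1 => A) 0 c)) y =
    totShuffle K A y (lof K ℕ (Chain K A) 0
      (PiTensorProduct.singleAlgHom (R := K) (A := fun _ : Fin 1 => A) 0 c)) := by
  have e : PiTensorProduct.singleAlgHom (R := K) (A := fun _ : Fin 1 => A) 0 c =
      PiTensorProduct.tprod K fun _ => c := by
    rw [PiTensorProduct.singleAlgHom_apply]; congr 1; ext i; fin_cases i; simp
  suffices h : totShuffle K A (lof K ℕ (Chain K A) 0 (PiTensorProduct.tprod K fun _ => c)) =
      (totShuffle K A).flip (lof K ℕ (Chain K A) 0 (PiTensorProduct.tprod K fun _ => c)) by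
    rw [e]; exact LinearMap.congr_fun h y
  refine DirectSum.linearMap_ext K fun q => PiTensorProduct.ext (MultilinearMap.ext fun b => ?_)
  refine (totShuffle_one_left c q b).trans ((totShuffle_one_right c q b).trans ?_).symm
  rw [mul_comm]

theorem totShuffle_algebraMap (r : K) (y : Tot K A) :
    totShuffle K A (lof K ℕ (Chain K A) 0
      (PiTensorProduct.singleAlgHom (R := K) (A := fun _ : Fin 1 => A) 0 (algebraMap K A r))) y =
    r • y := by
  have e : PiTensorProduct.singleAlgHom (R := K) (A := fun _ : Fin 1 => A) 0 (algebraMap K A r) =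
      r • PiTensorProduct.tprod K fun _ => (1 : A) := by
    rw [Algebra.algebraMap_eq_smul_one, map_smul, map_one]; rfl
  suffices h : totShuffle K A (lof K ℕ (Chain K A) 0
      (PiTensorProduct.tprod K fun _ => (1 : A))) = .id by
    rw [e, map_smul, map_smul, LinearMap.smul_apply, h, LinearMap.id_apply]
  refine DirectSum.linearMap_ext K fun q => PiTensorProduct.ext (MultilinearMap.ext fun b => ?_)
  refine (totShuffle_one_left 1 q b).trans ?_
  rw [one_mul, Fin.cons_self_tail]
  rfl

theorem HH.mul_assoc' (a b c : GradedMonoid (HH K A)) : a * b * c = a * (b * c) := by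
  obtain ⟨p, x⟩ := a
  obtain ⟨q, y⟩ := b
  obtain ⟨r, z⟩ := c
  obtain ⟨x, rfl⟩ := HH.mk_surjective p x
  obtain ⟨y, rfl⟩ := HH.mk_surjective q y
  obtain ⟨z, rfl⟩ := HH.mk_surjective r z
  have h : lof K ℕ (Chain K A) (p + q + r)
        (Hochschild.shuffle K A (p + q) r (Hochschild.shuffle K A p q x y) z) =
      lof K ℕ (Chain K A) (p + (q + r))
        (Hochschild.shuffle K A p (q + r) x (Hochschild.shuffle K A q r y z)) := by
    simp only [← totShuffle_lof, totShuffle_assoc]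
  exact HH.gradedMonoid_eq (add_assoc p q r) _ _ h

theorem HH.ofAlgebra_mul (s : K) (a : GradedMonoid (HH K A)) :
    GradedMonoid.mk (A := HH K A) 0 (HH.ofAlgebra K A (algebraMap K A s)) * a = s • a := by
  obtain ⟨q, y⟩ := a
  obtain ⟨y, rfl⟩ := HH.mk_surjective q y
  refine HH.gradedMonoid_eq (zero_add q) _ (s • y) ?_
  refine (totShuffle_lof 0 q _ _).symm.trans ((totShuffle_algebraMap s _).trans ?_)
  simp

theorem HH.mul_ofAlgebra (c : A) (a : GradedMonoid (HH K A)) :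
    GradedMonoid.mk (A := HH K A) 0 (HH.ofAlgebra K A c) * a =
      a * GradedMonoid.mk (A := HH K A) 0 (HH.ofAlgebra K A c) := by
  obtain ⟨q, y⟩ := a
  obtain ⟨y, rfl⟩ := HH.mk_surjective q y
  refine HH.gradedMonoid_eq (add_comm 0 q) _ _ ?_
  exact (totShuffle_lof 0 q _ _).symm.trans
    ((totShuffle_ofAlgebra_left c _).trans (totShuffle_lof q 0 _ _))

theorem HH.one_mul' (a : GradedMonoid (HH K A)) : 1 * a = a := by
  have := HH.ofAlgebra_mul (1 : K) a
  rw [map_one, one_smul] at this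
  exact this

theorem HH.mul_one' (a : GradedMonoid (HH K A)) : a * 1 = a :=
  (HH.mul_ofAlgebra 1 a).symm.trans (HH.one_mul' a)

/-- `HH_•(A)` is a graded ring under the shuffle product. -/
instance : DirectSum.GRing (HH K A) where
  one_mul := HH.one_mul'
  mul_one := HH.mul_one'
  mul_assoc := HH.mul_assoc'
  mul_zero _ := map_zero _
  zero_mul _ := LinearMap.map_zero₂ _ _
  mul_add _ := map_add _
  add_mul _ _ _ := LinearMap.map_add₂ _ _ _ _
  natCast n := HH.ofAlgebra K A n
  natCast_zero := by simp
  natCast_succ n := by rw [Nat.cast_succ, map_add]; rfl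
  intCast n := HH.ofAlgebra K A n
  intCast_ofNat n := by simp
  intCast_negSucc_ofNat n := by rw [Int.cast_negSucc, map_neg]

/-- `HH_•(A)` is a graded `K`-algebra, `r ∈ K` acting through the class of `r · 1` in `HH_0(A)`. -/
instance : DirectSum.GAlgebra K (HH K A) where
  toFun := (HH.ofAlgebra K A ∘ₗ Algebra.linearMap K A).toAddMonoidHom
  map_one := by simp; rfl
  map_mul r s := by
    refine Eq.trans ?_ (HH.ofAlgebra_mul r (GradedMonoid.mk (A := HH K A) 0
      (HH.ofAlgebra K A (algebraMap K A s)))).symm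
    change GradedMonoid.mk (A := HH K A) 0 (HH.ofAlgebra K A (algebraMap K A (r * s))) =
      GradedMonoid.mk (A := HH K A) 0 (r • HH.ofAlgebra K A (algebraMap K A s))
    rw [← map_smul, map_mul, Algebra.smul_def]
  commutes r x := HH.mul_ofAlgebra _ x
  smul_def r x := (HH.ofAlgebra_mul r x).symm

variable (K A) in
/-- The Hochschild homology ring `(HH_•(A), sh)`: the direct sum `⨁ₙ HH_n(A)` with the ring and
`K`-algebra structure that Mathlib attaches to the graded algebra above, i.e. the shuffle product. -/
abbrev HHRing : Type _ := ⨁ n : ℕ, HH K A n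

end Homology

end Hochschild

section Measuring

variable (K : Type*) {C A B : Type*} [CommRing K] [AddCommGroup C] [Module K C] [Coalgebra K C]

/-- `(C, φ)` is a coalgebra measuring from `A` to `B`: with `Δ c = ∑ c₁ ⊗ c₂`,
`φ(c)(a a') = ∑ φ(c₁)(a) φ(c₂)(a')` and `φ(c)(1) = ε(c) 1`. -/
structure IsMeasuring [Semiring A] [Algebra K A] [Semiring B] [Algebra K B]
    (φ : C →ₗ[K] A →ₗ[K] B) : Prop where
  map_mul : ∀ (c : C) (a a' : A), φ c (a * a') =
    LinearMap.mul' K B (TensorProduct.map (φ.flip a) (φ.flip a') (Coalgebra.comul (R := K) c))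
  map_one : ∀ c : C, φ c 1 = Coalgebra.counit (R := K) c • (1 : B)

end Measuring

namespace Hochschild

section Induced

variable (K C : Type*) [CommRing K] [AddCommGroup C] [Module K C] [Coalgebra K C]

/-- `c ⊗ (c₁ ⊗ ⋯ ⊗ c_n) ↦ c ⊗ c₁ ⊗ ⋯ ⊗ c_n`. -/
def tensorCons (n : ℕ) : C →ₗ[K] (⨂[K] _ : Fin n, C) →ₗ[K] (⨂[K] _ : Fin (n + 1), C) :=
  PiTensorProduct.lift.toLinearMap ∘ₗ
    MultilinearMap.curryLeft (PiTensorProduct.tprod K (s := fun _ : Fin (n + 1) => C))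

theorem tensorCons_tprod (n : ℕ) (c : C) (x : Fin n → C) :
    tensorCons K C n c (PiTensorProduct.tprod K x) = PiTensorProduct.tprod K (Fin.cons c x) := by
  simp [tensorCons]

/-- The iterated coproduct `Δⁿ : C → C^{⊗(n+1)}`: `Δ⁰ = id` and `Δⁿ⁺¹ = (id ⊗ Δⁿ) Δ`. -/
def iteratedComul : (n : ℕ) → C →ₗ[K] ⨂[K] _ : Fin (n + 1), C
  | 0 => (PiTensorProduct.subsingletonEquiv (R := K) (s := fun _ : Fin 1 => C) 0).symm.toLinearMap
  | n + 1 => TensorProduct.lift (tensorCons K C (n + 1)) ∘ₗ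
      LinearMap.lTensor C (iteratedComul n) ∘ₗ Coalgebra.comul

variable {K C} {A B : Type*} [CommRing A] [Algebra K A] [CommRing B] [Algebra K B]

/-- `φ̃(c)_n : C_n(A) → C_n(B)`, `(a₀, …, a_n) ↦ ∑ (φ(c₁)(a₀), …, φ(c_{n+1})(a_n))` where
`Δⁿ(c) = ∑ c₁ ⊗ ⋯ ⊗ c_{n+1}`. -/
def chainMap (φ : C →ₗ[K] A →ₗ[K] B) (n : ℕ) : C →ₗ[K] Chain K A n →ₗ[K] Chain K B n :=
  PiTensorProduct.piTensorHomMap ∘ₗ PiTensorProduct.map (fun _ => φ) ∘ₗ iteratedComul K C n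

open WithConv

variable [Coalgebra.IsCocomm K C]

/-- `a ↦ (c ↦ φ(c)(a))`, with values in the convolution algebra. -/
abbrev conv (φ : C →ₗ[K] A →ₗ[K] B) (a : A) : WithConv (C →ₗ[K] B) := toConv (φ.flip a)

variable (C) in
/-- Postcomposition with an algebra map is multiplicative for convolution. -/
def convPost {X Y : Type*} [CommRing X] [Algebra K X] [CommRing Y] [Algebra K Y] (h : X →ₐ[K] Y) :
    WithConv (C →ₗ[K] X) →* WithConv (C →ₗ[K] Y) where
  toFun f := toConv (h.toLinearMap ∘ₗ f.ofConv)
  map_one' := by ext c; simp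
  map_mul' f g := congrArg toConv (LinearMap.algHom_comp_convMul_distrib h f g)

theorem convPost_apply {X Y : Type*} [CommRing X] [Algebra K X] [CommRing Y] [Algebra K Y]
    (h : X →ₐ[K] Y) (f : WithConv (C →ₗ[K] X)) (c : C) : convPost C h f c = h (f c) := rfl

theorem convPost_comp {X Y Z : Type*} [CommRing X] [Algebra K X] [CommRing Y] [Algebra K Y]
    [CommRing Z] [Algebra K Z] (g : Y →ₐ[K] Z) (h : X →ₐ[K] Y) (f : WithConv (C →ₗ[K] X)) :
    convPost C g (convPost C h f) = convPost C (g.comp h) f := rfl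

theorem chainMap_tprod (φ : C →ₗ[K] A →ₗ[K] B) (n : ℕ) (a : Fin (n + 1) → A) (c : C) :
    chainMap φ n c (PiTensorProduct.tprod K a) =
      (∏ i, convPost C (PiTensorProduct.singleAlgHom (R := K) (A := fun _ : Fin (n + 1) => B) i)
        (conv φ (a i))) c := by
  induction n generalizing c with
  | zero =>
    have h : iteratedComul K C 0 c = PiTensorProduct.tprod K fun _ => c := by
      simp [iteratedComul]
    have hp : chainMap φ 0 c (PiTensorProduct.tprod K a) =
        PiTensorProduct.tprod K fun i => φ c (a i) := by
      simp only [chainMap, LinearMap.comp_apply, h, PiTensorProduct.map_tprod,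
        PiTensorProduct.piTensorHomMap_tprod_tprod]
    rw [hp, Fin.prod_univ_succ, Fin.prod_univ_zero, mul_one, convPost_apply, tprod_eq_prod,
      Fin.prod_univ_succ, Fin.prod_univ_zero, mul_one]
    rfl
  | succ n ih =>
    have step : ∀ (d : C) (t : ⨂[K] _ : Fin (n + 1), C),
        PiTensorProduct.piTensorHomMap (PiTensorProduct.map (fun _ => φ)
          (tensorCons K C (n + 1) d t)) (PiTensorProduct.tprod K a) =
        PiTensorProduct.singleAlgHom (R := K) (A := fun _ : Fin (n + 2) => B) 0 (φ d (a 0)) *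
          mergeMap K B Fin.succ (PiTensorProduct.piTensorHomMap (PiTensorProduct.map (fun _ => φ) t)
            (PiTensorProduct.tprod K (Fin.tail a))) := by
      intro d t
      induction t using PiTensorProduct.induction_on with
      | smul_tprod r x =>
        simp only [map_smul, LinearMap.smul_apply, tensorCons_tprod, PiTensorProduct.map_tprod,
          PiTensorProduct.piTensorHomMap_tprod_tprod, mergeMap_tprod_eq_prod, mul_smul_comm]
        congr 1
        rw [tprod_eq_prod, Fin.prod_univ_succ]
        rfl
      | add t t' h h' => simp only [map_add, LinearMap.add_apply, h, h', mul_add]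
    rw [Fin.prod_univ_succ]
    have h2 : (∏ i : Fin (n + 1), convPost C (PiTensorProduct.singleAlgHom (R := K)
        (A := fun _ : Fin (n + 2) => B) i.succ) (conv φ (a i.succ))) =
        toConv ((mergeMap K B Fin.succ).toLinearMap ∘ₗ
          (chainMap φ n).flip (PiTensorProduct.tprod K (Fin.tail a))) := by
      have h3 : ∀ i : Fin (n + 1), PiTensorProduct.singleAlgHom (R := K)
          (A := fun _ : Fin (n + 2) => B) i.succ = (mergeMap K B Fin.succ).comp
          (PiTensorProduct.singleAlgHom (R := K) (A := fun _ : Fin (n + 1) => B) i) := fun i => by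
        apply AlgHom.ext
        intro b
        rw [AlgHom.comp_apply, mergeMap_single]
      simp only [h3, ← convPost_comp, ← map_prod]
      ext c
      rw [convPost_apply]
      change _ = mergeMap K B Fin.succ (chainMap φ n c (PiTensorProduct.tprod K (Fin.tail a)))
      rw [ih]
      rfl
    rw [h2, LinearMap.convMul_apply]
    simp only [chainMap, LinearMap.comp_apply, iteratedComul]
    induction (Coalgebra.comul (R := K) c) using TensorProduct.induction_on with
    | zero => simp
    | add t t' h h' => simp only [map_add, LinearMap.add_apply, h, h']
    | tmul d d' =>
      rw [LinearMap.lTensor_tmul, TensorProduct.lift.tmul, step, TensorProduct.map_tmul,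
        LinearMap.mul'_apply]
      rfl

variable {φ : C →ₗ[K] A →ₗ[K] B}

/-- For a measuring, `conv` is multiplicative. -/
def convHom (hφ : IsMeasuring K φ) : A →* WithConv (C →ₗ[K] B) where
  toFun := conv φ
  map_one' := by
    ext c
    change φ c 1 = algebraMap K B _
    rw [hφ.map_one, Algebra.algebraMap_eq_smul_one]
  map_mul' a a' := by
    ext c
    exact hφ.map_mul c a a'

theorem chainMap_mergeMap (hφ : IsMeasuring K φ) {m n : ℕ} (f : Fin (m + 1) → Fin (n + 1))
    (c : C) (x : Chain K A m) :
    chainMap φ n c (mergeMap K A f x) = mergeMap K B f (chainMap φ m c x) := by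
  suffices h : chainMap φ n c ∘ₗ (mergeMap K A f).toLinearMap =
      (mergeMap K B f).toLinearMap ∘ₗ chainMap φ m c from LinearMap.congr_fun h x
  refine PiTensorProduct.ext (MultilinearMap.ext fun a => ?_)
  change chainMap φ n c (mergeMap K A f (PiTensorProduct.tprod K a)) =
    mergeMap K B f (chainMap φ m c (PiTensorProduct.tprod K a))
  rw [mergeMap_tprod, chainMap_tprod, chainMap_tprod, ← convPost_apply, map_prod]
  refine congrArg (fun g : WithConv (C →ₗ[K] Chain K B n) => g c) ?_
  have h1 : ∀ i, convPost C (mergeMap K B f) (convPost C (PiTensorProduct.singleAlgHom (R := K)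
      (A := fun _ : Fin (m + 1) => B) i) (conv φ (a i))) =
      convPost C (PiTensorProduct.singleAlgHom (R := K)
      (A := fun _ : Fin (n + 1) => B) (f i)) (convHom hφ (a i)) := fun i => by
    ext c
    exact mergeMap_single f i _
  have h2 : ∀ a, conv φ a = convHom hφ a := fun _ => rfl
  rw [Finset.prod_congr rfl fun i _ => h1 i]
  simp only [h2, map_prod]
  refine Eq.trans ?_ (Finset.prod_fiberwise Finset.univ f _)
  refine Finset.prod_congr rfl fun k _ => Finset.prod_congr rfl fun i hi => ?_
  rw [(Finset.mem_filter.1 hi).2]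

/-- `φ̃(c)` is a morphism of Hochschild complexes. -/
theorem chainMap_boundary (hφ : IsMeasuring K φ) (n : ℕ) (c : C) (x : Chain K A (n + 1)) :
    chainMap φ n c (boundary K A n x) = boundary K B n (chainMap φ (n + 1) c x) := by
  simp only [boundary, LinearMap.add_apply, LinearMap.sum_apply, LinearMap.smul_apply, map_add,
    map_sum, map_smul, AlgHom.toLinearMap_apply, chainMap_mergeMap hφ]

theorem chainMap_mem_cycles (hφ : IsMeasuring K φ) {n : ℕ} (c : C) {x : Chain K A n}
    (hx : x ∈ cycles K A n) : chainMap φ n c x ∈ cycles K B n := by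
  cases n with
  | zero => exact Submodule.mem_top
  | succ n =>
    rw [cycles, LinearMap.mem_ker] at *
    rw [← chainMap_boundary hφ, hx, map_zero]

theorem chainMap_mem_boundaries (hφ : IsMeasuring K φ) {n : ℕ} (c : C) {x : Chain K A n}
    (hx : x ∈ boundaries K A n) : chainMap φ n c x ∈ boundaries K B n := by
  obtain ⟨y, rfl⟩ := hx
  exact ⟨chainMap φ (n + 1) c y, (chainMap_boundary hφ n c y).symm⟩

/-- `φ̃(c)` on cycles. -/
def cyclesMap (hφ : IsMeasuring K φ) (n : ℕ) : C →ₗ[K] cycles K A n →ₗ[K] cycles K B n :=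
  LinearMap.mk₂ K (fun c x => ⟨chainMap φ n c x, chainMap_mem_cycles hφ c x.2⟩)
    (fun _ _ _ => Subtype.ext (by simp)) (fun _ _ _ => Subtype.ext (by simp))
    (fun _ _ _ => Subtype.ext (by simp)) (fun _ _ _ => Subtype.ext (by simp))

/-- `φ̃(c) : HH_n(A) → HH_n(B)`, `[x] ↦ [φ̃(c)(x)]` (see `HH.map_mk`). -/
def HH.map (hφ : IsMeasuring K φ) (n : ℕ) : C →ₗ[K] HH K A n →ₗ[K] HH K B n :=
  LinearMap.flip <| Submodule.liftQ _
    (LinearMap.flip <| (cyclesMap hφ n).compr₂ (HH.mk K B n))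
    (fun _ hx => LinearMap.ext fun c =>
      (HH.mk_eq_zero _).2 (chainMap_mem_boundaries hφ c hx))

theorem HH.map_mk (hφ : IsMeasuring K φ) (n : ℕ) (c : C) (x : cycles K A n) :
    HH.map hφ n c (HH.mk K A n x) =
      HH.mk K B n ⟨chainMap φ n c x, chainMap_mem_cycles hφ c x.2⟩ := rfl

/-- The induced map `φ̃ : C → Hom_K(HH_•(A), HH_•(B))`, degreewise given by `HH.map`. -/
def inducedMap (hφ : IsMeasuring K φ) : C →ₗ[K] HHRing K A →ₗ[K] HHRing K B :=
  LinearMap.flip <| DirectSum.toModule K ℕ _ fun n =>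
    LinearMap.flip <| (HH.map hφ n).compr₂ (DirectSum.lof K ℕ (HH K B) n)

theorem inducedMap_lof (hφ : IsMeasuring K φ) (n : ℕ) (c : C) (x : HH K A n) :
    inducedMap hφ c (DirectSum.lof K ℕ (HH K A) n x) =
      DirectSum.lof K ℕ (HH K B) n (HH.map hφ n c x) := by
  simp [inducedMap]

end Induced

end Hochschild

end

namespace Hochschild

open DirectSum WithConv

section ChainMap

variable {K A B C : Type*} [CommRing K] [CommRing A] [Algebra K A] [CommRing B] [Algebra K B]
  [AddCommGroup C] [Module K C] [Coalgebra K C] [Coalgebra.IsCocomm K C]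
  {φ : C →ₗ[K] A →ₗ[K] B}

/-! The argument takes place in convolution algebras. For a commutative algebra `X`, the linear maps
from `C` to `X` form an algebra under (f * g)(c) = ∑ f(c₁) g(c₂), with unit c ↦ ε(c) 1; it is
commutative because `C` is cocommutative. A measuring from `R` to `X` is the same as a linear map φ
for which r ↦ (c ↦ φ(c)(r)) is a monoid homomorphism from `R` to this algebra (`convHom`).
Identities about iterated coproducts thereby become identities between products in a commutative
monoid.

Fix a degree n and let eᵢ : B → B^{⊗(n+1)} insert an element in place i. By `chainMap_tprod`, the
map c ↦ φ̃(c)(a₀, …, a_n) is the convolution product over i of the maps c ↦ eᵢ(φ(c)(aᵢ)). Each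
factor is multiplicative in aᵢ, and in a commutative monoid a product of products may be regrouped
place by place. Hence φ̃ in degree n is again a measuring, from A^{⊗(n+1)} to B^{⊗(n+1)} with their
componentwise products (`isMeasuring_chainMap`). In terms of coproducts, the regrouping permutes the
2n + 2 tensor legs of an iterated coproduct of c.

The shuffle product is built from these componentwise products: x × y = ∑_σ sgn(σ) s_σ(x) t_σ(y),
where the algebra maps s_σ and t_σ spread the entries of x and y over the places prescribed by σ and
put 1 elsewhere; both keep place 0, where a₀ and a₀' meet. The maps φ̃(c) commute with all such
reindexing maps (`chainMap_mergeMap`), and they send a componentwise product to ∑ φ̃(c₁)(-)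
φ̃(c₂)(-). Applying both facts to each σ gives φ̃(c)(x × y) = ∑ φ̃(c₁)(x) × φ̃(c₂)(y)
(`chainMap_shuffle`); the signs are only scalars.

This identity is exact on chains, so it descends to homology classes without any homotopy, and
bilinearity carries it to the direct sum. The unit condition is the unit condition of the degree 0
measuring on chains. -/

/-! ### Convolution and the shuffle product on chains -/

/-- This is `chainMap_tprod` read as an equation in the convolution algebra, before evaluation at c.
With `convHom` in place of `conv`, each factor is visibly a composite of monoid homomorphisms
applied to aᵢ, so the general lemmas on homomorphisms apply to it. -/
theorem conv_chainMap_tprod (hφ : IsMeasuring K φ) (n : ℕ) (a : Fin (n + 1) → A) :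
    conv (chainMap φ n) (PiTensorProduct.tprod K a) =
      ∏ i, convPost C (PiTensorProduct.singleAlgHom (R := K) (A := fun _ : Fin (n + 1) => B) i)
        (convHom hφ (a i)) := by
  ext c
  -- The two formulas agree because `convHom hφ` is `conv φ` by definition.
  exact chainMap_tprod φ n a c

/-- In each degree, the maps induced by a measuring on Hochschild chains form a measuring for the
componentwise product of tensors. -/
theorem isMeasuring_chainMap (hφ : IsMeasuring K φ) (n : ℕ) : IsMeasuring K (chainMap φ n) where
  map_mul c x y := by
    -- Both sides are recast as bilinear maps in (x, y), the right one by evaluating the tensor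
    -- product of the two adjoint maps at Δ(c). It then suffices to compare them on pure tensors.
    suffices h : (LinearMap.mul K (Chain K A n)).compr₂ (chainMap φ n c) =
        ((TensorProduct.mapBilinear (RingHom.id K) C C (Chain K B n)
          (Chain K B n)).compl₁₂ (chainMap φ n).flip (chainMap φ n).flip).compr₂
          (LinearMap.mul' K (Chain K B n) ∘ₗ LinearMap.applyₗ (Coalgebra.comul (R := K) c)) from
      LinearMap.congr_fun₂ h x y
    refine PiTensorProduct.ext (MultilinearMap.ext fun a => PiTensorProduct.ext
      (MultilinearMap.ext fun a' => ?_))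
    -- By definition the right-hand side is the value at c of a convolution product.
    change chainMap φ n c (PiTensorProduct.tprod K a * PiTensorProduct.tprod K a') =
      (conv (chainMap φ n) (PiTensorProduct.tprod K a) *
        conv (chainMap φ n) (PiTensorProduct.tprod K a')) c
    -- Merging the two products over the places into one, with the two factors at place i side by
    -- side, requires the convolution algebra to be commutative: this is where cocommutativity
    -- enters.
    rw [conv_chainMap_tprod hφ, conv_chainMap_tprod hφ, ← Finset.prod_mul_distrib,
      PiTensorProduct.tprod_mul_tprod]
    -- At each place the two factors combine through `convPost` and then through `convHom`, the
    -- latter being multiplicative because φ is a measuring. What remains is the product formula for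
    -- the tensor with entries aᵢ a'ᵢ.
    simp only [← map_mul]
    exact congrArg (fun g : WithConv (C →ₗ[K] Chain K B n) => g c)
      (conv_chainMap_tprod hφ n (a * a'))
  map_one c := by
    -- The unit of A^{⊗(n+1)} is the tensor with all entries 1. Every factor is then the image of 1
    -- under homomorphisms, so the product is the convolution unit c ↦ ε(c) 1.
    have h := conv_chainMap_tprod hφ n (1 : Fin (n + 1) → A)
    simp only [Pi.one_apply, map_one, Finset.prod_const_one] at h
    refine (congrArg (fun g : WithConv (C →ₗ[K] Chain K B n) => g c) h).trans ?_
    exact Algebra.algebraMap_eq_smul_one (A := Chain K B n) (Coalgebra.counit (R := K) c)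

/-- `φ̃(c)(x × y) = ∑ φ̃(c₁)(x) × φ̃(c₂)(y)` for the shuffle product of chains. -/
theorem chainMap_shuffle (hφ : IsMeasuring K φ) {p q : ℕ} (c : C) {ι : Type*} (r : Coalgebra.Repr K c ι)
    (x : Chain K A p) (y : Chain K A q) :
    chainMap φ (p + q) c (shuffle K A p q x y) =
      ∑ i ∈ r.index, shuffle K B p q (chainMap φ p (r.left i) x) (chainMap φ q (r.right i) y) := by
  simp only [shuffle, LinearMap.sum_apply, LinearMap.smul_apply, LinearMap.compl₁₂_apply,
    AlgHom.toLinearMap_apply, LinearMap.mul_apply', map_sum, map_smul]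
  -- With the sum over shuffles outermost on the right as well, the two sides can be compared one σ
  -- at a time.
  rw [Finset.sum_comm]
  refine Finset.sum_congr rfl fun σ _ => ?_
  -- For a fixed σ the summand is a componentwise product of two spread-out tensors in degree p + q.
  -- The measuring property there splits it along Δ(c), and each φ̃ then moves past the spreading
  -- map, back to degrees p and q.
  rw [(isMeasuring_chainMap hφ (p + q)).map_mul, ← r.eq, ← Finset.smul_sum]
  simp only [map_sum, TensorProduct.map_tmul, LinearMap.flip_apply, LinearMap.mul'_apply,
    chainMap_mergeMap hφ]

/-! ### Passage to homology -/

/-- The products and the induced maps on homology are all computed on representing cycles, where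
`chainMap_shuffle` applies. A single representation `r` of Δ(c) serves all degrees and all classes,
which the extension to the direct sum relies on. -/
theorem HH.map_shuffle (hφ : IsMeasuring K φ) {p q : ℕ} (c : C) {ι : Type*} (r : Coalgebra.Repr K c ι)
    (x : HH K A p) (y : HH K A q) :
    HH.map hφ (p + q) c (HH.shuffle K A p q x y) =
      ∑ i ∈ r.index, HH.shuffle K B p q (HH.map hφ p (r.left i) x)
        (HH.map hφ q (r.right i) y) := by
  obtain ⟨x, rfl⟩ := HH.mk_surjective p x
  obtain ⟨y, rfl⟩ := HH.mk_surjective q y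
  simp only [HH.shuffle_mk, HH.map_mk, ← map_sum]
  -- The representing cycles are equal themselves, not merely up to a boundary.
  refine congrArg _ (Subtype.ext ?_)
  simpa only [AddSubmonoidClass.coe_finsetSum] using
    chainMap_shuffle hφ c r (x : Chain K A p) (y : Chain K A q)

/-- The tensor (1) is the unit of the algebra A^{⊗1} of 0-chains, so this is the unit condition of
the degree 0 case of `isMeasuring_chainMap`, taken to classes. -/
theorem HH.map_ofAlgebra_one (hφ : IsMeasuring K φ) (c : C) :
    HH.map hφ 0 c (HH.ofAlgebra K A 1) =
      Coalgebra.counit (R := K) c • HH.ofAlgebra K B 1 := by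
  simp only [HH.ofAlgebra, LinearMap.comp_apply, HH.map_mk, ← map_smul (HH.mk K B 0)]
  refine congrArg _ (Subtype.ext ?_)
  change chainMap φ 0 c (PiTensorProduct.singleAlgHom (R := K) (A := fun _ : Fin 1 => A) 0 1) =
    Coalgebra.counit (R := K) c •
      PiTensorProduct.singleAlgHom (R := K) (A := fun _ : Fin 1 => B) 0 1
  rw [map_one (PiTensorProduct.singleAlgHom (R := K) (A := fun _ : Fin 1 => A) 0),
    map_one (PiTensorProduct.singleAlgHom (R := K) (A := fun _ : Fin 1 => B) 0)]
  exact (isMeasuring_chainMap hφ 0).map_one c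

/-! ### The measuring on the direct sum -/

/-- The graded multiplication is `HH.shuffle` by definition; the `lof` form matches
`inducedMap_lof`. -/
theorem lof_mul_lof {p q : ℕ} (x : HH K A p) (y : HH K A q) :
    (lof K ℕ (HH K A) p x * lof K ℕ (HH K A) q y : HHRing K A) =
      lof K ℕ (HH K A) (p + q) (HH.shuffle K A p q x y) :=
  DirectSum.of_mul_of x y

theorem inducedMap_mul (hφ : IsMeasuring K φ) (c : C) (x y : HHRing K A) :
    inducedMap hφ c (x * y) = LinearMap.mul' K (HHRing K B) (TensorProduct.map
      ((inducedMap hφ).flip x) ((inducedMap hφ).flip y) (Coalgebra.comul (R := K) c)) := by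
  -- Δ(c) is written as a finite sum before x and y are decomposed, so the same sum is used for all
  -- homogeneous components. Both sides are additive in x and in y.
  have r := Coalgebra.Repr.arbitrary K c
  rw [← r.eq]
  simp only [map_sum, TensorProduct.map_tmul, LinearMap.flip_apply, LinearMap.mul'_apply]
  induction x using DirectSum.induction_on with
  | zero => simp
  | add x x' h h' => simp only [add_mul, map_add, h, h', Finset.sum_add_distrib]
  | of p x =>
    induction y using DirectSum.induction_on with
    | zero => simp
    | add y y' h h' => simp only [mul_add, map_add, h, h', Finset.sum_add_distrib]
    | of q y =>
      simp only [← DirectSum.lof_eq_of K, lof_mul_lof, inducedMap_lof, HH.map_shuffle hφ c r,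
        map_sum]

theorem inducedMap_one (hφ : IsMeasuring K φ) (c : C) :
    inducedMap hφ c 1 = Coalgebra.counit (R := K) c • (1 : HHRing K B) := by
  have h := inducedMap_lof hφ 0 c (HH.ofAlgebra K A 1)
  rw [HH.map_ofAlgebra_one, map_smul] at h
  -- The unit of `HHRing` is by definition the degree 0 inclusion of `HH.ofAlgebra K A 1`.
  exact h

end ChainMap

end Hochschild

/-- The coalgebra of the induced measuring is still `C`, so its cocommutativity is the instance
already assumed. The proof `hφ` is an argument of `inducedMap` because φ̃(c) descends to homology
through its compatibility with the differentials, which rests on the measuring property. -/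
theorem proposition2p5 {K A B C : Type*} [Field K] [CommRing A] [Algebra K A]
    [CommRing B] [Algebra K B] [AddCommGroup C] [Module K C] [Coalgebra K C]
    [Coalgebra.IsCocomm K C] (φ : C →ₗ[K] A →ₗ[K] B) (hφ : IsMeasuring K φ) :
    IsMeasuring K (Hochschild.inducedMap hφ) :=
  ⟨Hochschild.inducedMap_mul hφ, Hochschild.inducedMap_one hφ⟩
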